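/- Let $n\ge 1$, let $\mathbb{B}^n$ be the open Euclidean unit ball of $\mathbb{C}^n$ and $\mathbb{D}=\mathbb{B}^1$. A $C^2$ function $f:\mathbb{B}^n\to\mathbb{C}$ is pluriharmonic if for every $z\in\mathbb{B}^n$ and every unit vector $\theta\in\mathbb{C}^n$ the function $\zeta\mapsto f(z+\zeta\theta)$ is harmonic in $\{\zeta\in\mathbb{C}:|\zeta|<1-|z|\}$; $\mathscr{PH}(\mathbb{B}^n)$ denotes the set of all such functions. For $\alpha\in(0,1)$ let $\mathscr{L}_\alpha(\mathbb{B}^n)$ be the space of continuous $f:\mathbb{B}^n\to\mathbb{C}$ with $\|f\|_{\mathscr{L}_\alpha,s}:=\sup_{z\ne w}|f(z)-f(w)|/|z-w|^{\alpha}<\infty$, and equip $\mathscr{L}_\alpha(\mathbb{B}^n)\cap\mathscr{PH}(\mathbb{B}^n)$ with the norm $|f(0)|+\|f\|_{\mathscr{L}_\alpha,s}$. For a real-differentiable $f:\mathbb{B}^n\to\mathbb{C}$ put $$\Lambda_f(z)=\max_{|\theta|=1}\Bigl|\sum_{j=1}^n\frac{\partial f}{\partial z_j}(z)\,\theta_j+\sum_{j=1}^n\frac{\partial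 f}{\partial \bar z_j}(z)\,\overline{\theta_j}\Bigr|,\qquad \|f\|_{\mathscr{B}_\omega(\mathbb{B}^n)}=|f(0)|+\sup_{z\in\mathbb{B}^n}\frac{\Lambda_f(z)}{\omega(|z|)}\in[0,\infty].$$ **Theorem.** Let $\alpha,\beta\in(0,1)$ and $\omega(t)=1/(1-t)^{1-\beta}$ for $t\in[0,1)$. Let $\phi:\mathbb{B}^n\to\mathbb{D}$ be holomorphic and $C_\phi f=f\circ\phi$. (1) $C_\phi$ maps $\mathscr{L}_\alpha(\mathbb{D})\cap\mathscr{PH}(\mathbb{D})$ into $\mathscr{L}_\beta(\mathbb{B}^n)\cap\mathscr{PH}(\mathbb{B}^n)$ and is a bounded operator between these spaces if and only if $$\sup_{k\ge1}\,k^{-\alpha}\|\phi^k\|_{\mathscr{B}_\omega(\mathbb{B}^n)}<\infty .$$ (2) $C_\phi$ maps $\mathscr{L}_\alpha(\mathbb{D})\cap\mathscr{PH}(\mathbb{D})$ into $\mathscr{L}_\beta(\mathbb{B}^n)\cap\mathscr{PH}(\mathbb{B}^n)$ and is a compact operator between these spaces if and only if $\|\phi^k\|_{\mathscr{B}_\omega(\mathbb{B}^n)}<\infty$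 for every $k\ge1$ and $$\lim_{k\to\infty}k^{-\alpha}\|\phi^k\|_{\mathscr{B}_\omega(\mathbb{B}^n)}=0 .$$ -/

import Mathlib

open Set Filter Topology Metric
open scoped ENNReal ComplexConjugate

noncomputable section

/-- The open unit ball of `E`: this is `𝔻` for `E = ℂ` and `𝔹ⁿ` for `E = EuclideanSpace ℂ (Fin n)`. -/
abbrev UnitBall (E : Type*) [NormedAddCommGroup E] : Set E := ball (0 : E) 1

/-- The centre of the unit ball, as a point of the ball. -/
def UnitBall.center (E : Type*) [NormedAddCommGroup E] : UnitBall E :=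
  ⟨0, mem_ball_self one_pos⟩

section Spaces

variable {E : Type*} [NormedAddCommGroup E]

/-- Extension by zero of a function on the unit ball. It only serves to speak about derivatives
at points of the (open) ball, which do not depend on the values outside. -/
def zeroExtend (f : UnitBall E → ℂ) : E → ℂ := Function.extend Subtype.val f 0

theorem zeroExtend_apply (f : UnitBall E → ℂ) (z : UnitBall E) : zeroExtend f z = f z :=
  Subtype.val_injective.extend_apply f 0 z

theorem zeroExtend_comp (L : ℂ →L[ℝ] ℂ) (f : UnitBall E → ℂ) :
    zeroExtend (fun z => L (f z)) = L ∘ zeroExtend f := by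
  funext z
  by_cases h : z ∈ UnitBall E
  · have h1 := zeroExtend_apply (fun z => L (f z)) ⟨z, h⟩
    have h2 := zeroExtend_apply f ⟨z, h⟩
    simp only [Function.comp_apply] at *
    rw [h1, h2]
  · have hn : ¬ ∃ a : UnitBall E, (a : E) = z := by rintro ⟨a, rfl⟩; exact h a.2
    simp [zeroExtend, Function.extend_apply' _ _ _ hn]

theorem zeroExtend_add (f g : UnitBall E → ℂ) :
    zeroExtend (f + g) = zeroExtend f + zeroExtend g := by
  funext z
  by_cases h : z ∈ UnitBall E
  · have h1 := zeroExtend_apply (f + g) ⟨z, h⟩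
    have h2 := zeroExtend_apply f ⟨z, h⟩
    have h3 := zeroExtend_apply g ⟨z, h⟩
    simp only [Pi.add_apply] at *
    rw [h1, h2, h3]
  · have hn : ¬ ∃ a : UnitBall E, (a : E) = z := by rintro ⟨a, rfl⟩; exact h a.2
    simp [zeroExtend, Function.extend_apply' _ _ _ hn]

/-- The Lipschitz semi-norm of exponent `α`,
`sup_{z ≠ w} |f z - f w| / |z - w| ^ α ∈ [0, ∞]`. -/
def lipSeminorm (α : ℝ) (f : UnitBall E → ℂ) : ℝ≥0∞ :=
  ⨆ (z : UnitBall E) (w : UnitBall E) (_ : z ≠ w),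
    ENNReal.ofReal (‖f z - f w‖ / ‖(z : E) - w‖ ^ α)

theorem lipSeminorm_le_iff {α : ℝ} {f : UnitBall E → ℂ} {C : ℝ≥0∞} :
    lipSeminorm α f ≤ C ↔ ∀ z w : UnitBall E, z ≠ w →
      ENNReal.ofReal (‖f z - f w‖ / ‖(z : E) - w‖ ^ α) ≤ C := by
  simp [lipSeminorm, iSup_le_iff]

theorem le_lipSeminorm (α : ℝ) (f : UnitBall E → ℂ) {z w : UnitBall E} (h : z ≠ w) :
    ENNReal.ofReal (‖f z - f w‖ / ‖(z : E) - w‖ ^ α) ≤ lipSeminorm α f :=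
  lipSeminorm_le_iff.1 le_rfl z w h

theorem lipSeminorm_add_le (α : ℝ) (f g : UnitBall E → ℂ) :
    lipSeminorm α (f + g) ≤ lipSeminorm α f + lipSeminorm α g := by
  refine lipSeminorm_le_iff.2 fun z w h => ?_
  refine le_trans ?_ (add_le_add (le_lipSeminorm α f h) (le_lipSeminorm α g h))
  rw [← ENNReal.ofReal_add (by positivity) (by positivity), ← add_div]
  refine ENNReal.ofReal_le_ofReal (div_le_div_of_nonneg_right ?_ (by positivity))
  simpa [add_sub_add_comm] using norm_add_le (f z - f w) (g z - g w)

theorem lipSeminorm_smul_le (α : ℝ) (c : ℂ) (f : UnitBall E → ℂ) :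
    lipSeminorm α (c • f) ≤ ENNReal.ofReal ‖c‖ * lipSeminorm α f := by
  refine lipSeminorm_le_iff.2 fun z w h => ?_
  refine le_trans (le_of_eq ?_) (mul_le_mul_right (le_lipSeminorm α f h) _)
  rw [← ENNReal.ofReal_mul (norm_nonneg c)]
  simp [← mul_sub, mul_div_assoc]

theorem lipSeminorm_neg (α : ℝ) (f : UnitBall E → ℂ) :
    lipSeminorm α (-f) = lipSeminorm α f := by
  have key : ∀ g : UnitBall E → ℂ, lipSeminorm α (-g) ≤ lipSeminorm α g := fun g => by
    simpa using lipSeminorm_smul_le α (-1) g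
  exact le_antisymm (key f) (by simpa using key (-f))

theorem lipSeminorm_zero (α : ℝ) : lipSeminorm α (0 : UnitBall E → ℂ) = 0 := by
  refine le_antisymm (lipSeminorm_le_iff.2 fun z w _ => ?_) bot_le
  simp

/-- The Lipschitz space `𝓛_α` of the unit ball: continuous functions with finite semi-norm. -/
def lipschitzSpace (α : ℝ) (E : Type*) [NormedAddCommGroup E] :
    Submodule ℂ (UnitBall E → ℂ) where
  carrier := {f | Continuous f ∧ lipSeminorm α f < ∞}
  zero_mem' := ⟨continuous_const, by simp [lipSeminorm_zero]⟩
  add_mem' := fun {f g} hf hg => ⟨hf.1.add hg.1,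
    (lipSeminorm_add_le α f g).trans_lt (ENNReal.add_lt_top.2 ⟨hf.2, hg.2⟩)⟩
  smul_mem' := fun c f hf => ⟨hf.1.const_smul c,
    (lipSeminorm_smul_le α c f).trans_lt (ENNReal.mul_lt_top ENNReal.ofReal_lt_top hf.2)⟩

variable [NormedSpace ℂ E]

/-- A function on the unit ball is pluriharmonic if it is of class `C²` in the real sense and, for
every `z` in the ball and every unit vector `θ`, the function `ζ ↦ f (z + ζ θ)` is harmonic in the
disc `|ζ| < 1 - |z|`; here `1 - |z|` is the distance from `z` to the boundary of the ball. -/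
def IsPluriharmonic (f : UnitBall E → ℂ) : Prop :=
  ContDiffOn ℝ 2 (zeroExtend f) (UnitBall E) ∧
    ∀ z ∈ UnitBall E, ∀ θ ∈ sphere (0 : E) 1,
      InnerProductSpace.HarmonicOnNhd (fun ζ : ℂ => zeroExtend f (z + ζ • θ))
        (ball (0 : ℂ) (1 - ‖z‖))

theorem IsPluriharmonic.clm_comp {f : UnitBall E → ℂ} (hf : IsPluriharmonic f) (L : ℂ →L[ℝ] ℂ) :
    IsPluriharmonic (fun z => L (f z)) := by
  refine ⟨?_, fun z hz θ hθ ζ hζ => ?_⟩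
  · rw [zeroExtend_comp]
    exact L.contDiff.comp_contDiffOn hf.1
  · rw [zeroExtend_comp]
    exact (hf.2 z hz θ hθ ζ hζ).comp_CLM L

/-- The space `𝒫ℋ` of complex-valued pluriharmonic functions on the unit ball. -/
def pluriharmonicSpace (E : Type*) [NormedAddCommGroup E] [NormedSpace ℂ E] :
    Submodule ℂ (UnitBall E → ℂ) where
  carrier := {f | IsPluriharmonic f}
  zero_mem' := by
    have h : zeroExtend (0 : UnitBall E → ℂ) = fun _ => 0 := by
      funext z
      by_cases hz : z ∈ UnitBall E
      · exact zeroExtend_apply (0 : UnitBall E → ℂ) ⟨z, hz⟩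
      · have hn : ¬ ∃ a : UnitBall E, (a : E) = z := by rintro ⟨a, rfl⟩; exact hz a.2
        simp [zeroExtend, Function.extend_apply' _ _ _ hn]
    refine ⟨?_, fun z _ θ _ ζ _ => ?_⟩
    · rw [h]; exact contDiffOn_const
    · rw [h]; exact InnerProductSpace.harmonicAt_const 0
  add_mem' := fun {f g} hf hg => by
    refine ⟨?_, fun z hz θ hθ ζ hζ => ?_⟩
    · rw [zeroExtend_add]; exact hf.1.add hg.1
    · rw [zeroExtend_add]
      exact (hf.2 z hz θ hθ ζ hζ).add (hg.2 z hz θ hθ ζ hζ)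
  smul_mem' := fun c f hf => by
    exact hf.clm_comp ((ContinuousLinearMap.mul ℂ ℂ c).restrictScalars ℝ)

/-- The space `𝓛_α ∩ 𝒫ℋ` of the unit ball of `E`, to be equipped with the norm
`|f 0| + sup_{z ≠ w} |f z - f w| / |z - w| ^ α`. -/
def LipPH (α : ℝ) (E : Type*) [NormedAddCommGroup E] [NormedSpace ℂ E] : Type _ :=
  ↥(lipschitzSpace α E ⊓ pluriharmonicSpace E)

namespace LipPH

instance (α : ℝ) : AddCommGroup (LipPH α E) :=
  inferInstanceAs (AddCommGroup ↥(lipschitzSpace α E ⊓ pluriharmonicSpace E))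

instance (α : ℝ) : Module ℂ (LipPH α E) :=
  inferInstanceAs (Module ℂ ↥(lipschitzSpace α E ⊓ pluriharmonicSpace E))

/-- The underlying function on the unit ball. -/
def toFun {α : ℝ} (f : LipPH α E) : UnitBall E → ℂ := Subtype.val f

instance (α : ℝ) : CoeFun (LipPH α E) (fun _ => UnitBall E → ℂ) := ⟨toFun⟩

theorem ext {α : ℝ} {f g : LipPH α E} (h : f.toFun = g.toFun) : f = g := Subtype.ext h

theorem lipSeminorm_lt_top {α : ℝ} (f : LipPH α E) : lipSeminorm α f < ∞ := f.2.1.2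

theorem isPluriharmonic {α : ℝ} (f : LipPH α E) : IsPluriharmonic f := f.2.2

/-- The norm `|f 0| + sup_{z ≠ w} |f z - f w| / |z - w| ^ α`. -/
instance (α : ℝ) : Norm (LipPH α E) :=
  ⟨fun f => ‖f (UnitBall.center E)‖ + (lipSeminorm α f).toReal⟩

theorem norm_def {α : ℝ} (f : LipPH α E) :
    ‖f‖ = ‖f (UnitBall.center E)‖ + (lipSeminorm α f).toReal := rfl

instance (α : ℝ) : NormedAddCommGroup (LipPH α E) :=
  AddGroupNorm.toNormedAddCommGroup
    { toFun := fun f => ‖f‖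
      map_zero' := by
        have h : (0 : LipPH α E).toFun = 0 := rfl
        simp [norm_def, h, lipSeminorm_zero]
      add_le' := fun f g => by
        have h : (f + g).toFun = f.toFun + g.toFun := rfl
        have h1 := ENNReal.toReal_mono
          (ENNReal.add_lt_top.2 ⟨f.lipSeminorm_lt_top, g.lipSeminorm_lt_top⟩).ne
          (lipSeminorm_add_le α f.toFun g.toFun)
        rw [ENNReal.toReal_add f.lipSeminorm_lt_top.ne g.lipSeminorm_lt_top.ne] at h1
        have h2 := norm_add_le (f (UnitBall.center E)) (g (UnitBall.center E))
        simp only [norm_def, h, Pi.add_apply]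
        linarith
      neg' := fun f => by
        have h : (-f).toFun = -f.toFun := rfl
        simp only [norm_def, h, lipSeminorm_neg, Pi.neg_apply, norm_neg]
      eq_zero_of_map_eq_zero' := fun f hf => by
        change ‖f (UnitBall.center E)‖ + (lipSeminorm α f).toReal = 0 at hf
        obtain ⟨h0, h1⟩ := (add_eq_zero_iff_of_nonneg (norm_nonneg _) ENNReal.toReal_nonneg).1 hf
        have h2 : lipSeminorm α f = 0 :=
          ((ENNReal.toReal_eq_zero_iff _).1 h1).resolve_right f.lipSeminorm_lt_top.ne
        refine ext (funext fun z => ?_)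
        change f z = 0
        by_cases hz : z = UnitBall.center E
        · rw [hz]; exact norm_eq_zero.1 h0
        · have h3 := le_lipSeminorm α f.toFun hz
          rw [h2, nonpos_iff_eq_zero, ENNReal.ofReal_eq_zero] at h3
          have h4 : 0 < ‖(z : E) - (UnitBall.center E : E)‖ :=
            norm_pos_iff.2 (sub_ne_zero.2 fun h => hz (Subtype.ext h))
          have h5 := (div_le_iff₀ (Real.rpow_pos_of_pos h4 α)).1 h3
          rw [zero_mul] at h5
          have h6 := sub_eq_zero.1 (norm_le_zero_iff.1 h5)
          rw [h6]; exact norm_eq_zero.1 h0 }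

instance (α : ℝ) : NormedSpace ℂ (LipPH α E) where
  norm_smul_le := fun c f => by
    have h : (c • f).toFun = c • f.toFun := rfl
    have h1 := ENNReal.toReal_mono
      (ENNReal.mul_lt_top ENNReal.ofReal_lt_top f.lipSeminorm_lt_top).ne
      (lipSeminorm_smul_le α c f.toFun)
    rw [ENNReal.toReal_mul, ENNReal.toReal_ofReal (norm_nonneg c)] at h1
    change ‖(c • f).toFun (UnitBall.center E)‖ + (lipSeminorm α (c • f).toFun).toReal
      ≤ ‖c‖ * (‖f (UnitBall.center E)‖ + (lipSeminorm α f).toReal)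
    rw [h, Pi.smul_apply, norm_smul, mul_add]
    linarith

end LipPH

end Spaces

section Composition

variable {E : Type*} [NormedAddCommGroup E] [NormedSpace ℂ E] {φ : E → ℂ}

/-- The composition operator `C_φ f = f ∘ φ` of a map `φ` from the unit ball into the disc. -/
def compOp (hφ : MapsTo φ (UnitBall E) (UnitBall ℂ)) (f : UnitBall ℂ → ℂ) : UnitBall E → ℂ :=
  f ∘ hφ.restrict φ (UnitBall E) (UnitBall ℂ)

/-- `C_φ` maps `𝓛_α ∩ 𝒫ℋ` of the disc into `𝓛_β ∩ 𝒫ℋ` of the ball, and is a bounded operator. -/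
def CompOpIsBounded (α β : ℝ) (hφ : MapsTo φ (UnitBall E) (UnitBall ℂ)) : Prop :=
  ∃ T : LipPH α ℂ →L[ℂ] LipPH β E, ∀ f : LipPH α ℂ, (T f).toFun = compOp hφ f

/-- `C_φ` maps `𝓛_α ∩ 𝒫ℋ` of the disc into `𝓛_β ∩ 𝒫ℋ` of the ball, and is a compact operator. -/
def CompOpIsCompact (α β : ℝ) (hφ : MapsTo φ (UnitBall E) (UnitBall ℂ)) : Prop :=
  ∃ T : LipPH α ℂ →L[ℂ] LipPH β E,
    (∀ f : LipPH α ℂ, (T f).toFun = compOp hφ f) ∧ IsCompactOperator T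

end Composition

section Bloch

variable {n : ℕ}

/-- The Wirtinger derivative `∂f/∂z_k`. -/
def wirtinger (f : EuclideanSpace ℂ (Fin n) → ℂ) (k : Fin n) (z : EuclideanSpace ℂ (Fin n)) : ℂ :=
  (fderiv ℝ f z (EuclideanSpace.single k 1)
    - Complex.I * fderiv ℝ f z (EuclideanSpace.single k Complex.I)) / 2

/-- The conjugate Wirtinger derivative `∂f/∂z̄_k`. -/
def wirtingerBar (f : EuclideanSpace ℂ (Fin n) → ℂ) (k : Fin n) (z : EuclideanSpace ℂ (Fin n)) :
    ℂ :=
  (fderiv ℝ f z (EuclideanSpace.single k 1)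
    + Complex.I * fderiv ℝ f z (EuclideanSpace.single k Complex.I)) / 2

/-- `Λ_f(z)`, the maximum over unit vectors `θ` of
`|∑ (∂f/∂z_k) θ_k + ∑ (∂f/∂z̄_k) conj θ_k|`. -/
def maxDeriv (f : EuclideanSpace ℂ (Fin n) → ℂ) (z : EuclideanSpace ℂ (Fin n)) : ℝ≥0∞ :=
  ⨆ θ ∈ sphere (0 : EuclideanSpace ℂ (Fin n)) 1,
    ENNReal.ofReal
      ‖(∑ k, wirtinger f k z * θ k) + ∑ k, wirtingerBar f k z * conj (θ k)‖

/-- The norm `‖f‖_{𝓑_ω(𝔹ⁿ)} = |f 0| + sup_{z ∈ 𝔹ⁿ} Λ_f(z) / ω(|z|)`, with values in `[0, ∞]`. -/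
def blochNorm (ω : ℝ → ℝ) (f : EuclideanSpace ℂ (Fin n) → ℂ) : ℝ≥0∞ :=
  ENNReal.ofReal ‖f 0‖ +
    ⨆ z ∈ UnitBall (EuclideanSpace ℂ (Fin n)), maxDeriv f z / ENNReal.ofReal (ω ‖z‖)

/-- The weight `ω(t) = 1 / (1 - t) ^ (1 - β)`. -/
def lipWeight (β : ℝ) (t : ℝ) : ℝ := 1 / (1 - t) ^ (1 - β)

end Bloch

end

/-! Everything passes through the pointwise inequality `‖Dφ(z)‖ (1 - |φ(z)|)^(α-1) ≤ C (1 -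
|z|)^(β-1)`.

From powers to the inequality: since `D(φ^k) = k φ^(k-1) Dφ`, the bound on `k^(-α) ‖φ^k‖` controls
`k^(1-α) |φ|^(k-1) ‖Dφ‖`, and for `k` near `1 / (2 (1 - |φ(z)|))` the factor `k^(1-α) |φ(z)|^(k-1)`
dominates a multiple of `(1 - |φ(z)|)^(α-1)` (`exists_nat_rpow_mul_pow_ge`).

From the inequality to the operator: on the disc `f = Re A + i Re B` with `A`, `B` holomorphic.
Borel–Carathéodory and Cauchy turn the Hölder bound of `f` into `|A'|, |B'| ≤ 4 ‖f‖ (1 -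
|w|)^(α-1)`; the chain rule and the Hardy–Littlewood theorem (`holder_of_norm_fderiv_le`) then make
`f ∘ φ` Hölder of exponent `β`.

From the operator to powers: the functions `k^(-α) w^k` have norm at most 2, and Cauchy's estimate
bounds the Bloch norm of their images.

Compactness is the same argument with small constants. If the limit is zero, `C` may be replaced by
any `ε` where `|φ|` is close to 1; elsewhere uniform convergence of `A` and `B` suffices.
Conversely, the images of the normalised monomials stay in a compact set and tend to zero pointwise,
hence in norm. -/

/-! ### Hölder continuity and growth of the derivative. -/

theorem norm_fderiv_le_of_forall_ball {E : Type*} [NormedAddCommGroup E] [NormedSpace ℂ E]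
    {f : E → ℂ} {z : E} {r M : ℝ} (hr : 0 < r) (hf : DifferentiableOn ℂ f (ball z r))
    (hM : ∀ w ∈ ball z r, ‖f w‖ ≤ M) : ‖fderiv ℂ f z‖ ≤ M / r := by
  have hM0 : 0 ≤ M := (norm_nonneg _).trans (hM z (mem_ball_self hr))
  -- The bound holds on the open ball only, so Cauchy's estimate is used on slices of radius `s < r`
  -- and `s` tends to `r`.
  have key : ∀ s ∈ Ioo 0 r, ‖fderiv ℂ f z‖ ≤ M / s := by
    intro s hs
    refine ContinuousLinearMap.opNorm_le_of_unit_norm (by positivity [hs.1]) fun θ hθ => ?_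
    have hmem : ∀ ζ : ℂ, ‖ζ‖ ≤ s → z + ζ • θ ∈ ball z r := fun ζ hζ => by
      simp only [mem_ball, dist_eq_norm, add_sub_cancel_left, norm_smul, hθ, mul_one]
      exact hζ.trans_lt hs.2
    have hline : ∀ ζ : ℂ, HasDerivAt (fun ζ : ℂ => z + ζ • θ) θ ζ := fun ζ => by
      simpa using ((hasDerivAt_id ζ).smul_const θ).const_add z
    have hd : ∀ ζ : ℂ, ‖ζ‖ ≤ s →
        HasDerivAt (fun ζ : ℂ => f (z + ζ • θ)) (fderiv ℂ f (z + ζ • θ) θ) ζ := fun ζ hζ =>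
      ((hf.differentiableAt (isOpen_ball.mem_nhds (hmem ζ hζ))).hasFDerivAt.comp_hasDerivAt ζ
        (hline ζ))
    have h0 := (hd 0 (by simp [hs.1.le])).deriv
    simp only [zero_smul, add_zero] at h0
    rw [← h0]
    refine Complex.norm_deriv_le_of_forall_mem_sphere_norm_le hs.1 ?_ fun ζ hζ =>
      hM _ (hmem ζ (by simpa using (mem_sphere.1 hζ).le))
    refine DifferentiableOn.diffContOnCl fun ζ hζ => ?_
    have : ‖ζ‖ ≤ s := by simpa using closure_ball_subset_closedBall hζ
    exact (hd ζ this).differentiableAt.differentiableWithinAt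
  have hlim : Tendsto (fun s => M / s) (𝓝[<] r) (𝓝 (M / r)) :=
    (tendsto_const_nhds.div tendsto_id hr.ne').mono_left nhdsWithin_le_nhds
  refine ge_of_tendsto hlim ?_
  filter_upwards [Ioo_mem_nhdsLT hr] with s hs using key s hs

/-- Cauchy's estimate for `f - f z` on the largest ball about `z`, where the Hölder condition bounds
it by `S (1 - ‖z‖)^β`. -/
theorem norm_fderiv_le_of_holder {E : Type*} [NormedAddCommGroup E] [NormedSpace ℂ E]
    {f : E → ℂ} {β S : ℝ} (hβ : 0 < β) (hS : 0 ≤ S)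
    (hf : DifferentiableOn ℂ f (ball 0 1))
    (h : ∀ z ∈ ball (0 : E) 1, ∀ w ∈ ball (0 : E) 1, ‖f z - f w‖ ≤ S * ‖z - w‖ ^ β)
    {z : E} (hz : z ∈ ball (0 : E) 1) : ‖fderiv ℂ f z‖ ≤ S * (1 - ‖z‖) ^ (β - 1) := by
  have hz1 : 0 < 1 - ‖z‖ := by simpa using hz
  have hsub : ball z (1 - ‖z‖) ⊆ ball 0 1 := ball_subset_ball' (by simp)
  have := norm_fderiv_le_of_forall_ball (f := fun w => f w - f z) (M := S * (1 - ‖z‖) ^ β) hz1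
    ((hf.mono hsub).sub_const _) fun w hw => by
      refine (h w (hsub hw) z hz).trans ?_
      have : ‖w - z‖ ≤ 1 - ‖z‖ := by simpa [dist_eq_norm] using (mem_ball.1 hw).le
      gcongr
  rwa [fderiv_sub_const, mul_div_assoc, ← Real.rpow_sub_one hz1.ne'] at this

/-- Borel–Carathéodory turns the bound `M` on the real part in the disc of radius `R` into the bound
`2M` on the modulus in the disc of radius `R / 2`; Cauchy's estimate there gives `4M / R`. -/
theorem norm_deriv_le_of_re_holder {A : ℂ → ℂ} {α N : ℝ} (hα : 0 < α) (hN : 0 ≤ N)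
    (hA : DifferentiableOn ℂ A (ball 0 1))
    (h : ∀ z ∈ ball (0 : ℂ) 1, ∀ w ∈ ball (0 : ℂ) 1, |(A z).re - (A w).re| ≤ N * ‖z - w‖ ^ α)
    {z : ℂ} (hz : z ∈ ball (0 : ℂ) 1) :
    ‖fderiv ℂ A z‖ ≤ 4 * N * (1 - ‖z‖) ^ (α - 1) := by
  set R := 1 - ‖z‖ with hR
  have hR0 : 0 < R := by simpa [hR] using hz
  have hsub : ∀ ζ ∈ ball (0 : ℂ) R, z + ζ ∈ ball (0 : ℂ) 1 := fun ζ hζ => by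
    have h1 := norm_add_le z ζ
    simp only [mem_ball, dist_zero_right] at hζ ⊢
    linarith
  -- Strictness keeps `M` positive even when `N = 0`; `M` decreases to `N * R ^ α` at the end.
  have key : ∀ M, N * R ^ α < M → ‖fderiv ℂ A z‖ ≤ 4 * M / R := by
    intro M hM
    have hM0 : 0 < M := lt_of_le_of_lt (by positivity) hM
    set F : ℂ → ℂ := fun ζ => A (z + ζ) - A z with hF
    have hFd : DifferentiableOn ℂ F (ball 0 R) :=
      (hA.comp (differentiableOn_id.const_add z) hsub).sub_const _
    have hre : MapsTo F (ball 0 R) {z | z.re ≤ M} := fun ζ hζ => by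
      have h1 := (le_abs_self _).trans (h _ (hsub ζ hζ) z hz)
      have h2 : ‖z + ζ - z‖ ^ α ≤ R ^ α := by
        gcongr
        simpa using (mem_ball.1 hζ).le
      have h3 := mul_le_mul_of_nonneg_left h2 hN
      simp only [mem_ofPred_eq, hF, Complex.sub_re]
      linarith
    have hb : ∀ ζ ∈ ball (0 : ℂ) (R / 2), ‖F ζ‖ ≤ 2 * M := fun ζ hζ => by
      have hζ' : ‖ζ‖ < R / 2 := by simpa using hζ
      have h1 := Complex.borelCaratheodory_zero hM0 hFd hre hR0
        (ball_subset_ball (by linarith) hζ) (by simp [hF])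
      refine h1.trans ((div_le_iff₀ (by linarith)).2 ?_)
      nlinarith
    have h1 := norm_fderiv_le_of_forall_ball (by positivity)
      (hFd.mono (ball_subset_ball (by linarith))) hb
    have h2 : fderiv ℂ F 0 = fderiv ℂ A z := by
      rw [hF, fderiv_sub_const, fderiv_comp_add_left, add_zero]
    rw [h2] at h1
    refine h1.trans (le_of_eq ?_)
    field_simp
    ring
  have hlim : Tendsto (fun M => 4 * M / R) (𝓝[>] (N * R ^ α)) (𝓝 (4 * (N * R ^ α) / R)) :=
    ((tendsto_id.const_mul 4).div_const R).mono_left nhdsWithin_le_nhds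
  have := ge_of_tendsto hlim (eventually_mem_nhdsWithin.mono fun M hM => key M hM)
  rwa [← mul_assoc, mul_div_assoc, ← Real.rpow_sub_one hR0.ne'] at this

/-- Along the radius from `(1 - s) z` to `z` the distance to the sphere at time `t` is at least `s -
t`, and `M (s - t)^(β-1)` integrates to `M s^β / β`. A mean value inequality with the explicit
primitive replaces the integral, which is singular at `t = s`. -/
theorem norm_sub_smul_le_of_fderiv_le {E : Type*} [NormedAddCommGroup E] [NormedSpace ℂ E]
    {f : E → ℂ} {β M : ℝ} (hβ : β ∈ Ioo 0 1) (hM : 0 ≤ M)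
    (hf : DifferentiableOn ℂ f (ball 0 1))
    (h : ∀ z ∈ ball (0 : E) 1, ‖fderiv ℂ f z‖ ≤ M * (1 - ‖z‖) ^ (β - 1))
    {z : E} (hz : z ∈ ball (0 : E) 1) {s : ℝ} (hs : s ∈ Icc 0 1) :
    ‖f z - f ((((1 - s : ℝ)) : ℂ) • z)‖ ≤ M / β * s ^ β := by
  have hz1 : ‖z‖ < 1 := by simpa using hz
  set γ : ℝ → E := fun t => ((1 - s + t : ℝ) : ℂ) • z with hγ
  have hγn : ∀ t ∈ Icc 0 s, ‖γ t‖ = (1 - s + t) * ‖z‖ := fun t ht => by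
    rw [hγ, norm_smul, Complex.norm_real, Real.norm_of_nonneg (by linarith [ht.1, hs.2])]
  have hγlt : ∀ t ∈ Icc 0 s, γ t ∈ ball (0 : E) 1 := fun t ht => by
    rw [mem_ball_zero_iff, hγn t ht]
    nlinarith [ht.1, ht.2, hs.1, hs.2, norm_nonneg z]
  have hγd : ∀ t, HasDerivAt γ z t := fun t => by
    have h1 : HasDerivAt (fun t : ℝ => ((1 - s + t : ℝ) : ℂ)) 1 t := by
      simpa using ((hasDerivAt_id t).const_add (1 - s)).ofReal_comp
    simpa only [one_smul] using h1.smul_const z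
  have hd : ∀ t ∈ Icc 0 s, HasDerivAt (fun t => f (γ t)) (fderiv ℂ f (γ t) z) t := fun t ht =>
    ((hf.differentiableAt (isOpen_ball.mem_nhds (hγlt t ht))).hasFDerivAt.restrictScalars
      ℝ).comp_hasDerivAt t (hγd t)
  have hB : ∀ t ∈ Ico 0 s,
      HasDerivAt (fun t => M / β * (s ^ β - (s - t) ^ β)) (M * (s - t) ^ (β - 1)) t := by
    intro t ht
    have h1 : HasDerivAt (fun t => (s - t) ^ β) (-1 * β * (s - t) ^ (β - 1)) t :=
      ((hasDerivAt_id t).const_sub s).rpow_const (Or.inl (by simpa using (sub_pos.2 ht.2).ne'))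
    refine ((h1.const_sub (s ^ β)).const_mul (M / β)).congr_deriv ?_
    have := hβ.1.ne'
    field_simp
  have main := image_norm_le_of_norm_deriv_right_le_deriv_boundary' (a := 0) (b := s)
    (f := fun t => f (γ t) - f (γ 0)) (f' := fun t => fderiv ℂ f (γ t) z)
    (B := fun t => M / β * (s ^ β - (s - t) ^ β)) (B' := fun t => M * (s - t) ^ (β - 1))
    (fun t ht => ((hd t ht).sub_const _).continuousAt.continuousWithinAt)
    (fun t ht => ((hd t (Ico_subset_Icc_self ht)).sub_const _).hasDerivWithinAt)
    (by simp)
    (Continuous.continuousOn (by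
      have := hβ.1.le
      fun_prop (disch := assumption)))
    (fun t ht => (hB t ht).hasDerivWithinAt)
    (fun t ht => by
      have ht' := Ico_subset_Icc_self ht
      refine (ContinuousLinearMap.le_opNorm _ _).trans ?_
      refine (mul_le_of_le_one_right (norm_nonneg _) hz1.le).trans ((h _ (hγlt t ht')).trans ?_)
      refine mul_le_mul_of_nonneg_left ?_ hM
      refine Real.rpow_le_rpow_of_nonpos (sub_pos.2 ht.2) ?_ (by linarith [hβ.2])
      rw [hγn t ht']
      nlinarith [ht.1, ht.2, hs.1, hs.2, norm_nonneg z])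
    (right_mem_Icc.2 hs.1)
  have e1 : γ s = z := by simp [hγ]
  have e2 : γ 0 = ((1 - s : ℝ) : ℂ) • z := by simp [hγ]
  rw [e1, e2] at main
  simpa [Real.zero_rpow hβ.1.ne'] using main

/-- The Hardy–Littlewood theorem: a growth bound on the derivative yields Hölder continuity. -/
theorem holder_of_norm_fderiv_le {E : Type*} [NormedAddCommGroup E] [NormedSpace ℂ E]
    {f : E → ℂ} {β M : ℝ} (hβ : β ∈ Ioo 0 1) (hM : 0 ≤ M)
    (hf : DifferentiableOn ℂ f (ball 0 1))
    (h : ∀ z ∈ ball (0 : E) 1, ‖fderiv ℂ f z‖ ≤ M * (1 - ‖z‖) ^ (β - 1))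
    {z w : E} (hz : z ∈ ball (0 : E) 1) (hw : w ∈ ball (0 : E) 1) :
    ‖f z - f w‖ ≤ (2 / β + 2) * M * ‖z - w‖ ^ β := by
  rcases eq_or_ne z w with rfl | hne
  · simp [Real.zero_rpow hβ.1.ne']
  have hz1 : ‖z‖ < 1 := by simpa using hz
  have hw1 : ‖w‖ < 1 := by simpa using hw
  set d := ‖z - w‖ with hd
  have hd0 : 0 < d := norm_pos_iff.2 (sub_ne_zero.2 hne)
  have hd2 : d < 2 := (norm_sub_le z w).trans_lt (by linarith)
  -- The path from `z` to `w` goes radially inwards, across, and radially outwards. Since `d` may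
  -- approach 2, halving it keeps `s ≤ 1`.
  set s := d / 2 with hs
  have hsI : s ∈ Icc (0 : ℝ) 1 := ⟨by positivity, by rw [hs]; linarith⟩
  have hs0 : 0 < s := by positivity
  set a : ℂ := ((1 - s : ℝ) : ℂ) with ha
  have hna : ‖a‖ = 1 - s := by
    rw [ha, Complex.norm_real, Real.norm_of_nonneg (by linarith [hsI.2])]
  have hball : ∀ y ∈ ball (0 : E) 1, a • y ∈ closedBall (0 : E) (1 - s) := fun y hy => by
    have hy1 : ‖y‖ < 1 := by simpa using hy
    rw [mem_closedBall_zero_iff, norm_smul, hna]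
    nlinarith [hsI.2, norm_nonneg y]
  have hsub : closedBall (0 : E) (1 - s) ⊆ ball 0 1 := closedBall_subset_ball (by linarith)
  have h1 := norm_sub_smul_le_of_fderiv_le hβ hM hf h hz hsI
  have h2 := norm_sub_smul_le_of_fderiv_le hβ hM hf h hw hsI
  have h3 : ‖f (a • z) - f (a • w)‖ ≤ M * s ^ (β - 1) * ‖a • z - a • w‖ := by
    refine (convex_closedBall (0 : E) (1 - s)).norm_image_sub_le_of_norm_fderiv_le (𝕜 := ℂ)
      (fun y hy => hf.differentiableAt (isOpen_ball.mem_nhds (hsub hy))) (fun y hy => ?_)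
      (hball w hw) (hball z hz)
    refine (h y (hsub hy)).trans (mul_le_mul_of_nonneg_left ?_ hM)
    refine Real.rpow_le_rpow_of_nonpos hs0 ?_ (by linarith [hβ.2])
    have : ‖y‖ ≤ 1 - s := by simpa using hy
    linarith
  have h4 : ‖a • z - a • w‖ ≤ 2 * s := by
    rw [← smul_sub, norm_smul, hna, ← hd]
    nlinarith
  have h5 : M * s ^ (β - 1) * ‖a • z - a • w‖ ≤ 2 * M * s ^ β := by
    refine (mul_le_mul_of_nonneg_left h4 (by positivity)).trans (le_of_eq ?_)
    rw [Real.rpow_sub_one hs0.ne']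
    field_simp
  have h6 : ‖f z - f w‖ ≤ (2 / β + 2) * M * s ^ β := by
    have e : f z - f w = (f z - f (a • z)) + (f (a • z) - f (a • w)) - (f w - f (a • w)) := by ring
    have h7 := norm_sub_le ((f z - f (a • z)) + (f (a • z) - f (a • w))) (f w - f (a • w))
    have h8 := norm_add_le (f z - f (a • z)) (f (a • z) - f (a • w))
    have e2 : (2 / β + 2) * M * s ^ β = M / β * s ^ β + 2 * M * s ^ β + M / β * s ^ β := by ring
    rw [← e] at h7
    rw [e2]
    linarith
  have := hβ.1
  refine h6.trans (mul_le_mul_of_nonneg_left ?_ (by positivity))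
  exact Real.rpow_le_rpow hs0.le (by rw [hs]; linarith) hβ.1.le

/-- With `x = 1 / (2 (1 - r))` and `k = ⌊x⌋ + 1`, Bernoulli's inequality gives `r^(k-1) ≥ 1/2`, and
`k ≥ x` handles the other factor. The lower bound on `k` matters for compactness, where only large
powers are controlled. -/
theorem exists_nat_rpow_mul_pow_ge {α r : ℝ} (hα : α ∈ Ioo 0 1) (hr0 : 0 ≤ r) (hr : r < 1) :
    ∃ k : ℕ, 1 ≤ k ∧ 1 / (2 * (1 - r)) ≤ k ∧
      (1 - r) ^ (α - 1) ≤ 4 * ((k : ℝ) ^ (1 - α) * r ^ (k - 1)) := by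
  set x := 1 / (2 * (1 - r)) with hx
  have h1r : 0 < 1 - r := by linarith
  have hx0 : 0 < x := by positivity
  refine ⟨⌊x⌋₊ + 1, by omega, by exact_mod_cast (Nat.lt_floor_add_one x).le, ?_⟩
  have h1 : (1 : ℝ) / 2 ≤ r ^ ⌊x⌋₊ := by
    have hb := one_add_mul_le_pow (a := r - 1) (by linarith) ⌊x⌋₊
    have hf := Nat.floor_le hx0.le
    have : (⌊x⌋₊ : ℝ) * (1 - r) ≤ 1 / 2 := by
      calc (⌊x⌋₊ : ℝ) * (1 - r) ≤ x * (1 - r) := by gcongr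
        _ = 1 / 2 := by rw [hx]; field_simp
    rw [add_sub_cancel] at hb
    linarith
  have h2 : (1 - r) ^ (α - 1) ≤ 2 * (((⌊x⌋₊ + 1 : ℕ) : ℝ)) ^ (1 - α) := by
    have hk : x ≤ ((⌊x⌋₊ + 1 : ℕ) : ℝ) := by exact_mod_cast (Nat.lt_floor_add_one x).le
    have e : (1 - r) ^ (α - 1) = 2 ^ (1 - α) * x ^ (1 - α) := by
      rw [← Real.mul_rpow (by norm_num) hx0.le,
        show 2 * x = (1 - r)⁻¹ by rw [hx]; field_simp, Real.inv_rpow h1r.le, ← Real.rpow_neg h1r.le,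
        neg_sub]
    rw [e]
    have h3 : (2 : ℝ) ^ (1 - α) ≤ 2 := by
      simpa using Real.rpow_le_rpow_of_exponent_le (x := 2) (by norm_num)
        (show 1 - α ≤ 1 by linarith [hα.1])
    have h4 : 0 ≤ 1 - α := by linarith [hα.2]
    gcongr
  rw [Nat.add_sub_cancel]
  have h3 : 0 ≤ (((⌊x⌋₊ + 1 : ℕ) : ℝ)) ^ (1 - α) := by positivity
  nlinarith

/-! ### Smoothness of holomorphic functions of several variables. -/

section SeveralVariables

variable {E : Type*} [NormedAddCommGroup E] [NormedSpace ℂ E] [FiniteDimensional ℂ E]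
  {f : E → ℂ} {U : Set E}

/-- Directional derivatives of a holomorphic function of several variables are holomorphic. -/
theorem differentiableOn_fderiv_apply_complex (hU : IsOpen U) (hf : DifferentiableOn ℂ f U)
    (θ : E) : DifferentiableOn ℂ (fun z => fderiv ℂ f z θ) U := by
  intro z₀ hz₀
  refine DifferentiableAt.differentiableWithinAt ?_
  borelize E
  have : ProperSpace E := FiniteDimensional.proper ℂ E
  -- Three radii: `f` is bounded within `3r`, hence its derivative within `2r`, while the base point
  -- moves within `r`.
  obtain ⟨M, r, hr, hrU, hM⟩ : ∃ M r, 0 < r ∧ ball z₀ (3 * r) ⊆ U ∧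
      ∀ w ∈ ball z₀ (3 * r), ‖f w‖ ≤ M := by
    have h1 : ∀ᶠ w in 𝓝 z₀, w ∈ U ∧ ‖f w‖ ≤ ‖f z₀‖ + 1 :=
      (hU.eventually_mem hz₀).and (((hf.differentiableAt (hU.mem_nhds hz₀)).continuousAt.norm).eventually
        (eventually_le_nhds (by linarith)))
    obtain ⟨ε, hε, h⟩ := Metric.eventually_nhds_iff_ball.1 h1
    refine ⟨‖f z₀‖ + 1, ε / 3, by positivity, fun w hw => (h w ?_).1, fun w hw => (h w ?_).2⟩ <;>
    · convert hw using 2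
      ring
  have hbound : ∀ w ∈ ball z₀ (2 * r), ‖fderiv ℂ f w‖ ≤ M / r := fun w hw => by
    have hsub : ball w r ⊆ ball z₀ (3 * r) := ball_subset_ball' (by
      have := mem_ball.1 hw
      linarith)
    exact norm_fderiv_le_of_forall_ball hr (hf.mono (hsub.trans hrU)) fun y hy => hM y (hsub hy)
  have hdiff : ∀ w ∈ ball z₀ (2 * r), DifferentiableAt ℂ f w := fun w hw =>
    hf.differentiableAt (hU.mem_nhds (hrU (ball_subset_ball (by linarith) hw)))
  obtain ⟨ρ, hρ, hρθ⟩ : ∃ ρ : ℝ, 0 < ρ ∧ ρ * ‖θ‖ < r := by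
    refine ⟨r / (‖θ‖ + 1), by positivity, ?_⟩
    rw [div_mul_eq_mul_div, div_lt_iff₀ (by positivity)]
    nlinarith [norm_nonneg θ]
  have hmem : ∀ z ∈ ball z₀ r, ∀ ζ : ℂ, ‖ζ‖ ≤ ρ → z + ζ • θ ∈ ball z₀ (2 * r) := by
    intro z hz ζ hζ
    rw [mem_ball, dist_eq_norm] at hz ⊢
    have h1 : ‖ζ • θ‖ ≤ ρ * ‖θ‖ := by
      rw [norm_smul]
      gcongr
    have h2 := norm_add_le (z - z₀) (ζ • θ)
    rw [show z + ζ • θ - z₀ = z - z₀ + ζ • θ by abel]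
    linarith
  have hmemc : ∀ z ∈ ball z₀ r, ∀ t : ℝ, z + circleMap 0 ρ t • θ ∈ ball z₀ (2 * r) :=
    fun z hz t => hmem z hz _ (by simp [abs_of_pos hρ])
  have hline : ∀ (z : E) (ζ : ℂ), HasDerivAt (fun ζ : ℂ => z + ζ • θ) θ ζ := fun z ζ => by
    simpa using ((hasDerivAt_id ζ).smul_const θ).const_add z
  set c : ℝ → ℂ := fun t => deriv (circleMap 0 ρ) t * (circleMap 0 ρ t ^ 2)⁻¹ with hc
  have hcc : Continuous c := by
    have h0 : ∀ t, circleMap 0 ρ t ^ 2 ≠ 0 := fun t => by simp [hρ.ne']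
    simp only [hc, deriv_circleMap]
    exact ((continuous_circleMap 0 ρ).mul continuous_const).mul
      (((continuous_circleMap 0 ρ).pow 2).inv₀ h0)
  have hcn : ∀ t, ‖c t‖ = 1 / ρ := fun t => by
    simp only [hc, deriv_circleMap, norm_mul, norm_inv, norm_pow, norm_circleMap_zero,
      Complex.norm_I, abs_of_pos hρ]
    field_simp
  -- Cauchy's formula on the slice in direction `θ`, with a radius independent of `z`, so that it
  -- can be differentiated under the integral with `hbound` as domination.
  have hcauchy : ∀ z ∈ ball z₀ r, fderiv ℂ f z θ = (2 * Real.pi * Complex.I : ℂ)⁻¹ •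
      ∫ t in (0 : ℝ)..2 * Real.pi, c t * f (z + circleMap 0 ρ t • θ) := by
    intro z hz
    have hd : ∀ ζ : ℂ, ‖ζ‖ ≤ ρ →
        HasDerivAt (fun ζ : ℂ => f (z + ζ • θ)) (fderiv ℂ f (z + ζ • θ) θ) ζ := fun ζ hζ =>
      (hdiff _ (hmem z hz ζ hζ)).hasFDerivAt.comp_hasDerivAt ζ (hline z ζ)
    have h0 := (hd 0 (by simp [hρ.le])).deriv
    simp only [zero_smul, add_zero] at h0
    rw [← h0]
    have hdc : DiffContOnCl ℂ (fun ζ : ℂ => f (z + ζ • θ)) (ball 0 ρ) := by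
      refine DifferentiableOn.diffContOnCl fun ζ hζ => ?_
      have : ‖ζ‖ ≤ ρ := by simpa using closure_ball_subset_closedBall hζ
      exact (hd ζ this).differentiableAt.differentiableWithinAt
    have h2 := hdc.deriv_eq_smul_circleIntegral hρ
    rw [eq_inv_smul_iff₀ Complex.two_pi_I_ne_zero, ← h2]
    simp only [circleIntegral, hc, smul_eq_mul, sub_zero, one_div, mul_assoc]
  have hev : (fun z => fderiv ℂ f z θ) =ᶠ[𝓝 z₀] fun z => (2 * Real.pi * Complex.I : ℂ)⁻¹ •
      ∫ t in (0 : ℝ)..2 * Real.pi, c t * f (z + circleMap 0 ρ t • θ) :=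
    eventually_of_mem (ball_mem_nhds z₀ hr) hcauchy
  refine (hev.differentiableAt_iff).2 (DifferentiableAt.fun_const_smul ?_ _)
  have hcont : ∀ z ∈ ball z₀ r, Continuous fun t => c t * f (z + circleMap 0 ρ t • θ) := by
    intro z hz
    refine hcc.mul (continuous_iff_continuousAt.2 fun t => ?_)
    exact ContinuousAt.comp (f := fun t => z + circleMap 0 ρ t • θ)
      (hdiff _ (hmemc z hz t)).continuousAt (by fun_prop)
  refine (intervalIntegral.hasFDerivAt_integral_of_dominated_of_fderiv_le
    (F := fun z t => c t * f (z + circleMap 0 ρ t • θ))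
    (F' := fun z t => c t • fderiv ℂ f (z + circleMap 0 ρ t • θ))
    (bound := fun _ => 1 / ρ * (M / r)) (ball_mem_nhds z₀ hr)
    (eventually_of_mem (ball_mem_nhds z₀ hr) fun z hz => (hcont z hz).aestronglyMeasurable)
    ((hcont z₀ (mem_ball_self hr)).intervalIntegrable _ _) ?_ ?_ (by simp) ?_).differentiableAt
  · have h1 : Measurable fun t : ℝ => z₀ + circleMap 0 ρ t • θ :=
      Continuous.measurable (by fun_prop)
    exact (hcc.measurable.smul ((measurable_fderiv ℂ f).comp h1)).aestronglyMeasurable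
  · refine Eventually.of_forall fun t _ z hz => ?_
    rw [norm_smul, hcn]
    exact mul_le_mul_of_nonneg_left (hbound _ (hmemc z hz t)) (by positivity)
  · refine Eventually.of_forall fun t _ z hz => ?_
    have h1 := (hdiff _ (hmemc z hz t)).hasFDerivAt
    have h2 : HasFDerivAt (fun z : E => z + circleMap 0 ρ t • θ) (ContinuousLinearMap.id ℂ E) z :=
      (hasFDerivAt_id z).add_const _
    exact (h1.comp z h2).const_mul (c t)

/-- A holomorphic function of several variables is smooth. -/
theorem contDiffOn_of_differentiableOn_complex (hU : IsOpen U) (m : ℕ) :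
    ∀ {f : E → ℂ}, DifferentiableOn ℂ f U → ContDiffOn ℂ m f U := by
  induction m with
  | zero => exact fun hf => contDiffOn_zero.2 hf.continuousOn
  | succ m ih =>
    intro f hf
    rw [Nat.cast_succ]
    refine (contDiffOn_succ_iff_fderiv_of_isOpen hU).2 ⟨hf, by simp, ?_⟩
    exact contDiffOn_clm_apply.2 fun θ => ih (differentiableOn_fderiv_apply_complex hU hf θ)

end SeveralVariables

/-! ### Pluriharmonic functions as pairs of real parts. -/

section Pluriharmonic

variable {E : Type*} [NormedAddCommGroup E] [NormedSpace ℂ E]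

/-- `f = Re A + i Re B` on the unit ball, with `A` and `B` holomorphic. -/
structure IsRePair (f : UnitBall E → ℂ) (A B : E → ℂ) : Prop where
  left : DifferentiableOn ℂ A (ball 0 1)
  right : DifferentiableOn ℂ B (ball 0 1)
  apply : ∀ z : UnitBall E, f z = ((A z).re : ℂ) + Complex.I * ((B z).re : ℂ)

theorem IsRePair.isPluriharmonic [FiniteDimensional ℂ E] {f : UnitBall E → ℂ} {A B : E → ℂ}
    (h : IsRePair f A B) : IsPluriharmonic f := by
  set L : ℂ →L[ℝ] ℂ := Complex.ofRealCLM.comp Complex.reCLM with hL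
  set L' : ℂ →L[ℝ] ℂ := ((ContinuousLinearMap.mul ℂ ℂ Complex.I).restrictScalars ℝ).comp L with hL'
  have heq : EqOn (zeroExtend f) (fun z => L (A z) + L' (B z)) (UnitBall E) := fun z hz => by
    simpa [hL, hL'] using (zeroExtend_apply f ⟨z, hz⟩).trans (h.apply ⟨z, hz⟩)
  refine ⟨?_, fun z hz θ hθ ζ hζ => ?_⟩
  · refine ContDiffOn.congr ?_ heq
    have hA := (contDiffOn_of_differentiableOn_complex isOpen_ball 2 h.left).restrict_scalars ℝ
    have hB := (contDiffOn_of_differentiableOn_complex isOpen_ball 2 h.right).restrict_scalars ℝ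
    exact (L.contDiff.comp_contDiffOn hA).add (L'.contDiff.comp_contDiffOn hB)
  · have hmap : MapsTo (fun ζ : ℂ => z + ζ • θ) (ball 0 (1 - ‖z‖)) (UnitBall E) := fun ξ hξ => by
      have h1 := norm_add_le z (ξ • θ)
      rw [norm_smul, mem_sphere_zero_iff_norm.1 hθ, mul_one] at h1
      have h2 : ‖ξ‖ < 1 - ‖z‖ := by simpa using hξ
      exact mem_ball_zero_iff.2 (by linarith)
    have hline : Differentiable ℂ (fun ζ : ℂ => z + ζ • θ) := by fun_prop
    have hnhds := isOpen_ball.mem_nhds hζ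
    have han : ∀ {g : E → ℂ}, DifferentiableOn ℂ g (ball 0 1) →
        InnerProductSpace.HarmonicAt (fun ζ : ℂ => g (z + ζ • θ)) ζ := fun hg =>
      ((hg.comp hline.differentiableOn hmap).analyticAt hnhds).harmonicAt
    have hev : (fun ζ : ℂ => zeroExtend f (z + ζ • θ)) =ᶠ[𝓝 ζ]
        (L ∘ fun ζ : ℂ => A (z + ζ • θ)) + (L' ∘ fun ζ : ℂ => B (z + ζ • θ)) :=
      eventually_of_mem hnhds fun ξ hξ => heq (hmap hξ)
    exact (InnerProductSpace.harmonicAt_congr_nhds hev).2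
      (((han h.left).comp_CLM L).add ((han h.right).comp_CLM L'))

theorem exists_re_eq_of_harmonicOnNhd {u : ℂ → ℝ}
    (hu : InnerProductSpace.HarmonicOnNhd u (ball 0 1)) :
    ∃ A : ℂ → ℂ, DifferentiableOn ℂ A (ball 0 1) ∧ (A 0).im = 0 ∧
      ∀ z ∈ ball (0 : ℂ) 1, (A z).re = u z := by
  obtain ⟨F, hF, hFu⟩ := hu.exists_analyticOnNhd_ball_re_eq
  -- Removing an imaginary constant leaves the real part unchanged and makes `A 0` real, so `f 0`
  -- controls it.
  refine ⟨fun z => F z - Complex.I * ((F 0).im : ℂ), hF.differentiableOn.sub_const _, by simp,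
    fun z hz => ?_⟩
  simpa using hFu hz

/-- The slice through the centre in direction 1 is the whole disc, so the real and imaginary parts
of `f` are harmonic there. -/
theorem IsPluriharmonic.exists_isRePair {f : UnitBall ℂ → ℂ} (hf : IsPluriharmonic f) :
    ∃ A B : ℂ → ℂ, IsRePair f A B ∧ (A 0).im = 0 ∧ (B 0).im = 0 := by
  have h := hf.2 0 (mem_ball_self one_pos) 1 (by simp)
  simp only [zero_add, smul_eq_mul, mul_one, norm_zero, sub_zero] at h
  obtain ⟨A, hA, hA0, hAu⟩ := exists_re_eq_of_harmonicOnNhd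
    (u := Complex.reCLM ∘ zeroExtend f) fun z hz => (h z hz).comp_CLM Complex.reCLM
  obtain ⟨B, hB, hB0, hBu⟩ := exists_re_eq_of_harmonicOnNhd
    (u := Complex.imCLM ∘ zeroExtend f) fun z hz => (h z hz).comp_CLM Complex.imCLM
  refine ⟨A, B, ⟨hA, hB, fun z => ?_⟩, hA0, hB0⟩
  rw [hAu z z.2, hBu z z.2]
  simp only [Function.comp_apply, zeroExtend_apply, Complex.reCLM_apply, Complex.imCLM_apply]
  rw [mul_comm]
  exact (Complex.re_add_im _).symm

end Pluriharmonic

/-! ### The Bloch norm of holomorphic functions. -/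

section Bloch

variable {n : ℕ}

/-- The conjugate Wirtinger derivatives vanish, which leaves the complex derivative alone. -/
theorem maxDeriv_eq_of_differentiableAt {h : EuclideanSpace ℂ (Fin n) → ℂ}
    {z : EuclideanSpace ℂ (Fin n)} (hh : DifferentiableAt ℂ h z) :
    maxDeriv h z = ⨆ θ ∈ sphere (0 : EuclideanSpace ℂ (Fin n)) 1,
      ENNReal.ofReal ‖fderiv ℂ h z θ‖ := by
  have hI : ∀ k : Fin n, EuclideanSpace.single k Complex.I =
      Complex.I • EuclideanSpace.single k (1 : ℂ) := fun k => by
    ext j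
    by_cases hj : j = k <;> simp [hj]
  have h2 : ∀ k : Fin n, fderiv ℝ h z (EuclideanSpace.single k Complex.I) =
      Complex.I * fderiv ℂ h z (EuclideanSpace.single k 1) := fun k => by
    rw [hh.fderiv_restrictScalars ℝ, ContinuousLinearMap.coe_restrictScalars', hI, map_smul,
      smul_eq_mul]
  have h1 : ∀ k : Fin n, fderiv ℝ h z (EuclideanSpace.single k 1) =
      fderiv ℂ h z (EuclideanSpace.single k 1) := fun k => by
    rw [hh.fderiv_restrictScalars ℝ, ContinuousLinearMap.coe_restrictScalars']
  have hw : ∀ k, wirtinger h k z = fderiv ℂ h z (EuclideanSpace.single k 1) := fun k => by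
    rw [wirtinger, h1, h2, ← mul_assoc, Complex.I_mul_I]
    ring
  have hwb : ∀ k, wirtingerBar h k z = 0 := fun k => by
    rw [wirtingerBar, h1, h2, ← mul_assoc, Complex.I_mul_I]
    ring
  refine iSup_congr fun θ => iSup_congr fun _ => ?_
  simp only [hw, hwb, zero_mul, Finset.sum_const_zero, add_zero]
  have hθ : θ = ∑ k, θ k • EuclideanSpace.single k (1 : ℂ) := by
    simpa using ((EuclideanSpace.basisFun (Fin n) ℂ).sum_repr θ).symm
  conv_rhs => rw [hθ, map_sum]
  simp [mul_comm]

theorem maxDeriv_le_ofReal_iff {h : EuclideanSpace ℂ (Fin n) → ℂ}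
    {z : EuclideanSpace ℂ (Fin n)} (hh : DifferentiableAt ℂ h z) {C : ℝ} (hC : 0 ≤ C) :
    maxDeriv h z ≤ ENNReal.ofReal C ↔ ‖fderiv ℂ h z‖ ≤ C := by
  rw [maxDeriv_eq_of_differentiableAt hh, iSup₂_le_iff]
  constructor
  · intro H
    refine ContinuousLinearMap.opNorm_le_of_unit_norm hC fun θ hθ => ?_
    exact (ENNReal.ofReal_le_ofReal_iff hC).1 (H θ (mem_sphere_zero_iff_norm.2 hθ))
  · intro H θ hθ
    refine ENNReal.ofReal_le_ofReal (((fderiv ℂ h z).le_opNorm θ).trans ?_)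
    rwa [mem_sphere_zero_iff_norm.1 hθ, mul_one]

theorem lipWeight_eq_rpow {β t : ℝ} (ht : t < 1) : lipWeight β t = (1 - t) ^ (β - 1) := by
  rw [lipWeight, one_div, ← Real.rpow_neg (by linarith), neg_sub]

theorem blochNorm_le_ofReal {β a S : ℝ} {h : EuclideanSpace ℂ (Fin n) → ℂ}
    (hh : DifferentiableOn ℂ h (ball 0 1)) (hS : 0 ≤ S) (h0 : ‖h 0‖ ≤ a)
    (hd : ∀ z ∈ ball (0 : EuclideanSpace ℂ (Fin n)) 1,
      ‖fderiv ℂ h z‖ ≤ S * (1 - ‖z‖) ^ (β - 1)) :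
    blochNorm (lipWeight β) h ≤ ENNReal.ofReal (a + S) := by
  rw [blochNorm, ENNReal.ofReal_add ((norm_nonneg _).trans h0) hS]
  refine add_le_add (ENNReal.ofReal_le_ofReal h0) (iSup₂_le fun z hz => ?_)
  have hz1 : ‖z‖ < 1 := by simpa using hz
  rw [lipWeight_eq_rpow hz1]
  refine ENNReal.div_le_of_le_mul ?_
  rw [← ENNReal.ofReal_mul hS]
  have : 0 ≤ 1 - ‖z‖ := by linarith
  exact (maxDeriv_le_ofReal_iff (hh.differentiableAt (isOpen_ball.mem_nhds hz)) (by positivity)).2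
    (hd z hz)

theorem norm_fderiv_le_of_blochNorm_le {β S : ℝ} {h : EuclideanSpace ℂ (Fin n) → ℂ}
    (hh : DifferentiableOn ℂ h (ball 0 1)) (hS : 0 ≤ S)
    (hb : blochNorm (lipWeight β) h ≤ ENNReal.ofReal S)
    {z : EuclideanSpace ℂ (Fin n)} (hz : z ∈ ball (0 : EuclideanSpace ℂ (Fin n)) 1) :
    ‖fderiv ℂ h z‖ ≤ S * (1 - ‖z‖) ^ (β - 1) := by
  have hz1 : 0 < 1 - ‖z‖ := by simpa using hz
  have h1 := (le_iSup₂ (f := fun z (_ : z ∈ UnitBall (EuclideanSpace ℂ (Fin n))) =>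
    maxDeriv h z / ENNReal.ofReal (lipWeight β ‖z‖)) z hz).trans (le_add_self.trans hb)
  have hw : 0 < (1 - ‖z‖) ^ (β - 1) := by positivity
  rw [lipWeight_eq_rpow (by linarith),
    ENNReal.div_le_iff (by simpa using hw) ENNReal.ofReal_ne_top, ← ENNReal.ofReal_mul hS] at h1
  exact (maxDeriv_le_ofReal_iff (hh.differentiableAt (isOpen_ball.mem_nhds hz)) (by positivity)).1 h1

theorem natCast_rpow_eq_ofReal {k : ℕ} (hk : 1 ≤ k) (s : ℝ) :
    (k : ℝ≥0∞) ^ s = ENNReal.ofReal ((k : ℝ) ^ s) := by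
  rw [← ENNReal.ofReal_rpow_of_pos (by exact_mod_cast hk), ENNReal.ofReal_natCast]

theorem norm_fderiv_pow {E : Type*} [NormedAddCommGroup E] [NormedSpace ℂ E] {φ : E → ℂ} {z : E}
    (hφ : DifferentiableAt ℂ φ z) (k : ℕ) :
    ‖fderiv ℂ (fun z => φ z ^ k) z‖ = k * ‖φ z‖ ^ (k - 1) * ‖fderiv ℂ φ z‖ := by
  rw [(hφ.hasFDerivAt.pow k).fderiv, norm_smul]
  simp

theorem rpow_mul_norm_fderiv_le_of_blochNorm_le {α β S : ℝ} {φ : EuclideanSpace ℂ (Fin n) → ℂ}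
    (hφ : DifferentiableOn ℂ φ (ball 0 1)) (hS : 0 ≤ S) {k : ℕ} (hk : 1 ≤ k)
    (hb : (k : ℝ≥0∞) ^ (-α) * blochNorm (lipWeight β) (fun z => φ z ^ k) ≤ ENNReal.ofReal S)
    {z : EuclideanSpace ℂ (Fin n)} (hz : z ∈ ball (0 : EuclideanSpace ℂ (Fin n)) 1) :
    (k : ℝ) ^ (1 - α) * ‖φ z‖ ^ (k - 1) * ‖fderiv ℂ φ z‖ ≤ S * (1 - ‖z‖) ^ (β - 1) := by
  have hk0 : (0 : ℝ) < k := by exact_mod_cast hk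
  have hc : 0 < (k : ℝ) ^ (-α) := by positivity
  have hb' : blochNorm (lipWeight β) (fun z => φ z ^ k) ≤ ENNReal.ofReal ((k : ℝ) ^ α * S) := by
    rw [natCast_rpow_eq_ofReal hk, mul_comm, ← ENNReal.le_div_iff_mul_le (by simp [hc]) (by simp),
      ← ENNReal.ofReal_div_of_pos hc, Real.rpow_neg hk0.le, div_inv_eq_mul, mul_comm] at hb
    exact hb
  have h1 := norm_fderiv_le_of_blochNorm_le (hφ.fun_pow k) (by positivity) hb' hz
  rw [norm_fderiv_pow (hφ.differentiableAt (isOpen_ball.mem_nhds hz))] at h1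
  have h2 := mul_le_mul_of_nonneg_left h1 hc.le
  have e1 : (k : ℝ) ^ (-α) * ((k : ℝ) ^ α * S * (1 - ‖z‖) ^ (β - 1)) = S * (1 - ‖z‖) ^ (β - 1) := by
    rw [← mul_assoc, ← mul_assoc, ← Real.rpow_add hk0, neg_add_cancel, Real.rpow_zero, one_mul]
  have e2 : (k : ℝ) ^ (1 - α) = (k : ℝ) ^ (-α) * k := by
    rw [sub_eq_add_neg, add_comm, Real.rpow_add hk0, Real.rpow_one]
  rw [e1] at h2
  rw [e2]
  linarith

end Bloch

/-! ### Hölder estimates in the function spaces, and monomials. -/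

section Holder

variable {E : Type*} [NormedAddCommGroup E]

theorem lipSeminorm_le_ofReal {α N : ℝ} {f : UnitBall E → ℂ}
    (h : ∀ z w : UnitBall E, ‖f z - f w‖ ≤ N * ‖(z : E) - w‖ ^ α) :
    lipSeminorm α f ≤ ENNReal.ofReal N := by
  refine lipSeminorm_le_iff.2 fun z w hzw => ENNReal.ofReal_le_ofReal ?_
  have : 0 < ‖(z : E) - w‖ := norm_pos_iff.2 (sub_ne_zero.2 fun h => hzw (Subtype.ext h))
  exact (div_le_iff₀ (by positivity)).2 (h z w)

variable [NormedSpace ℂ E]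

theorem IsPluriharmonic.continuous {f : UnitBall E → ℂ} (hf : IsPluriharmonic f) :
    Continuous f := by
  have h := continuousOn_iff_continuous_domRestrict.1 hf.1.continuousOn
  convert h using 1
  funext z
  exact (zeroExtend_apply f z).symm

namespace LipPH

variable {α : ℝ}

theorem lipSeminorm_toReal_le (f : LipPH α E) :
    (lipSeminorm α f.toFun).toReal ≤ ‖f‖ := by
  rw [norm_def]
  linarith [norm_nonneg (f (UnitBall.center E))]

theorem norm_center_le (f : LipPH α E) : ‖f (UnitBall.center E)‖ ≤ ‖f‖ := by
  rw [norm_def]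
  linarith [ENNReal.toReal_nonneg (a := lipSeminorm α f.toFun)]

theorem norm_sub_le_seminorm (f : LipPH α E) (z w : UnitBall E) :
    ‖f z - f w‖ ≤ (lipSeminorm α f.toFun).toReal * ‖(z : E) - w‖ ^ α := by
  rcases eq_or_ne z w with rfl | hzw
  · simp only [sub_self, norm_zero]
    positivity
  have : 0 < ‖(z : E) - w‖ := norm_pos_iff.2 (sub_ne_zero.2 fun h => hzw (Subtype.ext h))
  exact (div_le_iff₀ (by positivity)).1 (ENNReal.ofReal_le_iff_le_toReal f.lipSeminorm_lt_top.ne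
    |>.1 (le_lipSeminorm α f.toFun hzw))

theorem norm_sub_le (f : LipPH α E) (z w : UnitBall E) :
    ‖f z - f w‖ ≤ ‖f‖ * ‖(z : E) - w‖ ^ α :=
  (f.norm_sub_le_seminorm z w).trans (by gcongr; exact f.lipSeminorm_toReal_le)

theorem norm_apply_le (hα : 0 ≤ α) (f : LipPH α E) (z : UnitBall E) : ‖f z‖ ≤ ‖f‖ := by
  have h1 := f.norm_sub_le_seminorm z (UnitBall.center E)
  have h2 : ‖(z : E) - (UnitBall.center E : E)‖ ^ α ≤ 1 := by
    refine Real.rpow_le_one (norm_nonneg _) ?_ hα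
    simpa [UnitBall.center] using (mem_ball_zero_iff.1 z.2).le
  have h3 := mul_le_of_le_one_right (ENNReal.toReal_nonneg (a := lipSeminorm α f.toFun)) h2
  have h4 := norm_sub_norm_le (f z) (f (UnitBall.center E))
  rw [norm_def]
  linarith

/-- A pluriharmonic function that is Hölder continuous, as an element of `𝓛_α ∩ 𝒫ℋ`. -/
def ofHolder (f : UnitBall E → ℂ) (hf : IsPluriharmonic f) (N : ℝ)
    (h : ∀ z w : UnitBall E, ‖f z - f w‖ ≤ N * ‖(z : E) - w‖ ^ α) : LipPH α E :=
  ⟨f, ⟨hf.continuous, (lipSeminorm_le_ofReal h).trans_lt ENNReal.ofReal_lt_top⟩, hf⟩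

theorem norm_le_of_holder {N : ℝ} (hN : 0 ≤ N) (f : LipPH α E)
    (h : ∀ z w : UnitBall E, ‖f z - f w‖ ≤ N * ‖(z : E) - w‖ ^ α) :
    ‖f‖ ≤ ‖f (UnitBall.center E)‖ + N := by
  rw [norm_def]
  gcongr
  exact ENNReal.toReal_le_of_le_ofReal hN (lipSeminorm_le_ofReal h)

end LipPH

/-- Interpolation between the Lipschitz bound `k ‖z - w‖` and the trivial bound 2, with weights `α`
and `1 - α`. This growth `k^α` explains the normalisation `k^(-α)`. -/
theorem norm_pow_sub_pow_le_rpow {α : ℝ} (hα : α ∈ Ioo 0 1) {z w : ℂ} (hz : ‖z‖ ≤ 1)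
    (hw : ‖w‖ ≤ 1) (k : ℕ) : ‖z ^ k - w ^ k‖ ≤ 2 * (k : ℝ) ^ α * ‖z - w‖ ^ α := by
  have h1 : ‖z ^ k - w ^ k‖ ≤ k * ‖z - w‖ := by
    rw [(Commute.all z w).mul_geom_sum₂ k |>.symm, norm_mul, mul_comm]
    gcongr
    refine (norm_sum_le _ _).trans ((Finset.sum_le_card_nsmul _ _ 1 fun i _ => ?_).trans (by simp))
    rw [norm_mul, norm_pow, norm_pow]
    exact mul_le_one₀ (pow_le_one₀ (norm_nonneg _) hz) (by positivity)
      (pow_le_one₀ (norm_nonneg _) hw)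
  have h2 : ‖z ^ k - w ^ k‖ ≤ 2 := by
    refine (norm_sub_le _ _).trans ?_
    rw [norm_pow, norm_pow]
    linarith [pow_le_one₀ (n := k) (norm_nonneg _) hz, pow_le_one₀ (n := k) (norm_nonneg _) hw]
  have hα1 : 0 ≤ 1 - α := by linarith [hα.2]
  calc ‖z ^ k - w ^ k‖ = ‖z ^ k - w ^ k‖ ^ (1 - α) * ‖z ^ k - w ^ k‖ ^ α := by
        rw [← Real.rpow_add' (norm_nonneg _) (by simp), sub_add_cancel, Real.rpow_one]
    _ ≤ 2 ^ (1 - α) * (k * ‖z - w‖) ^ α := by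
        have := hα.1.le
        gcongr
    _ ≤ 2 * (k * ‖z - w‖) ^ α := by
        gcongr
        simpa using Real.rpow_le_rpow_of_exponent_le (x := 2) (by norm_num)
          (show 1 - α ≤ 1 by linarith [hα.1])
    _ = 2 * (k : ℝ) ^ α * ‖z - w‖ ^ α := by
        rw [Real.mul_rpow (by positivity) (norm_nonneg _), mul_assoc]

theorem isPluriharmonic_of_differentiableOn [FiniteDimensional ℂ E] {h : E → ℂ}
    (hh : DifferentiableOn ℂ h (ball 0 1)) :
    IsPluriharmonic (fun z : UnitBall E => h z) := by
  -- The imaginary part of `h` is the real part of `-i h`.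
  refine IsRePair.isPluriharmonic (A := h) (B := fun z => -Complex.I * h z)
    ⟨hh, hh.const_mul _, fun z => ?_⟩
  apply Complex.ext <;> simp

/-- The monomial `w ↦ w ^ k` as an element of `𝓛_α ∩ 𝒫ℋ` of the disc. -/
noncomputable def LipPH.monomial {α : ℝ} (hα : α ∈ Ioo 0 1) (k : ℕ) : LipPH α ℂ :=
  LipPH.ofHolder (fun w => (w : ℂ) ^ k)
    (isPluriharmonic_of_differentiableOn (h := fun w => w ^ k) (by fun_prop)) (2 * (k : ℝ) ^ α)
    fun z w => norm_pow_sub_pow_le_rpow hα (mem_ball_zero_iff.1 z.2).le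
      (mem_ball_zero_iff.1 w.2).le k

theorem LipPH.norm_monomial_le {α : ℝ} (hα : α ∈ Ioo 0 1) {k : ℕ} (hk : 1 ≤ k) :
    ‖LipPH.monomial hα k‖ ≤ 2 * (k : ℝ) ^ α := by
  refine (LipPH.norm_le_of_holder (N := 2 * (k : ℝ) ^ α) (by positivity) _ fun z w =>
    norm_pow_sub_pow_le_rpow hα (mem_ball_zero_iff.1 z.2).le
      (mem_ball_zero_iff.1 w.2).le k).trans (le_of_eq ?_)
  have : (LipPH.monomial hα k) (UnitBall.center ℂ) = 0 := zero_pow (by omega)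
  rw [this, norm_zero, zero_add]

end Holder

/-! ### Estimates for `f ∘ φ` through the holomorphic pair. -/

namespace IsRePair

variable {E : Type*} [NormedAddCommGroup E] [NormedSpace ℂ E] {f : UnitBall E → ℂ} {A B : E → ℂ}

theorem re_apply (h : IsRePair f A B) (z : UnitBall E) : (f z).re = (A z).re := by
  simp [h.apply z]

theorem im_apply (h : IsRePair f A B) (z : UnitBall E) : (f z).im = (B z).re := by
  simp [h.apply z]

theorem norm_apply_le (h : IsRePair f A B) (z : UnitBall E) : ‖f z‖ ≤ ‖A z‖ + ‖B z‖ := by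
  refine (Complex.norm_le_abs_re_add_abs_im _).trans ?_
  rw [h.re_apply, h.im_apply]
  exact add_le_add (Complex.abs_re_le_norm _) (Complex.abs_re_le_norm _)

theorem norm_sub_le (h : IsRePair f A B) (z w : UnitBall E) :
    ‖f z - f w‖ ≤ ‖A z - A w‖ + ‖B z - B w‖ := by
  refine (Complex.norm_le_abs_re_add_abs_im _).trans ?_
  rw [Complex.sub_re, Complex.sub_im, h.re_apply, h.im_apply, h.re_apply, h.im_apply,
    ← Complex.sub_re, ← Complex.sub_re]
  exact add_le_add (Complex.abs_re_le_norm _) (Complex.abs_re_le_norm _)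

theorem sub {g : UnitBall E → ℂ} {A' B' : E → ℂ} (h : IsRePair f A B) (h' : IsRePair g A' B') :
    IsRePair (f - g) (fun z => A z - A' z) (fun z => B z - B' z) := by
  refine ⟨h.left.sub h'.left, h.right.sub h'.right, fun z => ?_⟩
  rw [Pi.sub_apply, h.apply z, h'.apply z]
  push_cast [Complex.sub_re]
  ring

theorem compOp {f : UnitBall ℂ → ℂ} {A B : ℂ → ℂ} (h : IsRePair f A B) {φ : E → ℂ}
    (hφ : DifferentiableOn ℂ φ (UnitBall E)) (hmaps : MapsTo φ (UnitBall E) (UnitBall ℂ)) :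
    IsRePair (_root_.compOp hmaps f) (A ∘ φ) (B ∘ φ) :=
  ⟨h.left.comp hφ hmaps, h.right.comp hφ hmaps, fun z => h.apply (hmaps.restrict φ _ _ z)⟩

/-- Chain rule and Hardy–Littlewood for `A ∘ φ` and `B ∘ φ`; the leading factor 2 counts the two of
them. -/
theorem norm_compOp_sub_le {f : UnitBall ℂ → ℂ} {A B : ℂ → ℂ} (h : IsRePair f A B) {φ : E → ℂ}
    (hφ : DifferentiableOn ℂ φ (UnitBall E)) (hmaps : MapsTo φ (UnitBall E) (UnitBall ℂ))
    {β M : ℝ} (hβ : β ∈ Ioo 0 1) (hM : 0 ≤ M)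
    (hA : ∀ z ∈ UnitBall E,
      ‖fderiv ℂ A (φ z)‖ * ‖fderiv ℂ φ z‖ ≤ M * (1 - ‖z‖) ^ (β - 1))
    (hB : ∀ z ∈ UnitBall E,
      ‖fderiv ℂ B (φ z)‖ * ‖fderiv ℂ φ z‖ ≤ M * (1 - ‖z‖) ^ (β - 1)) (z w : UnitBall E) :
    ‖_root_.compOp hmaps f z - _root_.compOp hmaps f w‖ ≤
      2 * (2 / β + 2) * M * ‖(z : E) - w‖ ^ β := by
  have key : ∀ {F : ℂ → ℂ}, DifferentiableOn ℂ F (ball 0 1) → (∀ z ∈ UnitBall E,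
      ‖fderiv ℂ F (φ z)‖ * ‖fderiv ℂ φ z‖ ≤ M * (1 - ‖z‖) ^ (β - 1)) →
      ‖(F ∘ φ) z - (F ∘ φ) w‖ ≤ (2 / β + 2) * M * ‖(z : E) - w‖ ^ β := fun {F} hF hb => by
    refine holder_of_norm_fderiv_le hβ hM (hF.comp hφ hmaps) (fun y hy => ?_) z.2 w.2
    have h1 : fderiv ℂ (F ∘ φ) y = (fderiv ℂ F (φ y)).comp (fderiv ℂ φ y) :=
      fderiv_comp y (hF.differentiableAt (isOpen_ball.mem_nhds (hmaps hy)))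
        (hφ.differentiableAt (isOpen_ball.mem_nhds hy))
    rw [h1]
    exact (ContinuousLinearMap.opNorm_comp_le _ _).trans (hb y hy)
  have h1 := (h.compOp hφ hmaps).norm_sub_le z w
  linarith [key h.left hA, key h.right hB]

end IsRePair

theorem LipPH.exists_isRePair {α : ℝ} (hα : α ∈ Ioo 0 1) (f : LipPH α ℂ) :
    ∃ A B : ℂ → ℂ, IsRePair f.toFun A B ∧ (A 0).im = 0 ∧ (B 0).im = 0 ∧
      (∀ w ∈ ball (0 : ℂ) 1, ‖fderiv ℂ A w‖ ≤ 4 * ‖f‖ * (1 - ‖w‖) ^ (α - 1)) ∧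
      ∀ w ∈ ball (0 : ℂ) 1, ‖fderiv ℂ B w‖ ≤ 4 * ‖f‖ * (1 - ‖w‖) ^ (α - 1) := by
  obtain ⟨A, B, h, hA, hB⟩ := f.isPluriharmonic.exists_isRePair
  refine ⟨A, B, h, hA, hB, fun w hw => ?_, fun w hw => ?_⟩
  · refine norm_deriv_le_of_re_holder hα.1 (norm_nonneg f) h.left (fun x hx y hy => ?_) hw
    have h1 := (Complex.abs_re_le_norm _).trans (f.norm_sub_le ⟨x, hx⟩ ⟨y, hy⟩)
    rwa [Complex.sub_re, h.re_apply, h.re_apply] at h1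
  · refine norm_deriv_le_of_re_holder hα.1 (norm_nonneg f) h.right (fun x hx y hy => ?_) hw
    have h1 := (Complex.abs_im_le_norm _).trans (f.norm_sub_le ⟨x, hx⟩ ⟨y, hy⟩)
    rwa [Complex.sub_im, h.im_apply, h.im_apply] at h1

/-! ### Boundedness, and the estimates behind compactness. -/

section Operator

variable {E : Type*} [NormedAddCommGroup E] [NormedSpace ℂ E] {φ : E → ℂ} {α β : ℝ}

theorem compOpIsBounded_of_norm_fderiv_le [FiniteDimensional ℂ E] (hα : α ∈ Ioo 0 1)
    (hβ : β ∈ Ioo 0 1) (hφ : DifferentiableOn ℂ φ (UnitBall E))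
    (hmaps : MapsTo φ (UnitBall E) (UnitBall ℂ)) {C : ℝ} (hC : 0 ≤ C)
    (h : ∀ z ∈ UnitBall E,
      ‖fderiv ℂ φ z‖ * (1 - ‖φ z‖) ^ (α - 1) ≤ C * (1 - ‖z‖) ^ (β - 1)) :
    CompOpIsBounded α β hmaps := by
  have hβ0 := hβ.1
  have key : ∀ f : LipPH α ℂ, IsPluriharmonic (compOp hmaps f.toFun) ∧
      ∀ z w : UnitBall E, ‖compOp hmaps f.toFun z - compOp hmaps f.toFun w‖ ≤
        2 * (2 / β + 2) * (4 * ‖f‖ * C) * ‖(z : E) - w‖ ^ β := by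
    intro f
    obtain ⟨A, B, hAB, -, -, hA, hB⟩ := f.exists_isRePair hα
    refine ⟨(hAB.compOp hφ hmaps).isPluriharmonic,
      hAB.norm_compOp_sub_le hφ hmaps hβ (by positivity) (fun z hz => ?_) fun z hz => ?_⟩
    · have h1 := mul_le_mul_of_nonneg_right (hA _ (hmaps hz)) (norm_nonneg (fderiv ℂ φ z))
      have h2 := mul_le_mul_of_nonneg_left (h z hz) (norm_nonneg f)
      linarith
    · have h1 := mul_le_mul_of_nonneg_right (hB _ (hmaps hz)) (norm_nonneg (fderiv ℂ φ z))
      have h2 := mul_le_mul_of_nonneg_left (h z hz) (norm_nonneg f)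
      linarith
  let T : LipPH α ℂ →ₗ[ℂ] LipPH β E :=
    { toFun := fun f => LipPH.ofHolder (compOp hmaps f.toFun) (key f).1 _ (key f).2
      map_add' := fun _ _ => rfl
      map_smul' := fun _ _ => rfl }
  -- The summand 1 pays for the value at the centre, the rest for the semi-norm.
  refine ⟨T.mkContinuous (1 + 2 * (2 / β + 2) * (4 * C)) fun f => ?_, fun f => rfl⟩
  refine (LipPH.norm_le_of_holder (by positivity) (T f) (key f).2).trans ?_
  have h1 : ‖(T f) (UnitBall.center E)‖ ≤ ‖f‖ := f.norm_apply_le hα.1.le _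
  linarith

/-- A pointwise limit along an ultrafilter of uniformly Hölder functions is uniform. -/
theorem exists_tendstoUniformlyOn_of_holder {ι : Type*} (U : Ultrafilter ι) {A : ι → ℂ → ℂ}
    {K : ℝ} (hα : 0 < α) (hK : 0 ≤ K) (h0 : ∀ᶠ i in (U : Filter ι), ‖A i 0‖ ≤ 1)
    (h : ∀ᶠ i in (U : Filter ι), ∀ z ∈ ball (0 : ℂ) 1, ∀ w ∈ ball (0 : ℂ) 1,
      ‖A i z - A i w‖ ≤ K * ‖z - w‖ ^ α) :
    ∃ A' : ℂ → ℂ, TendstoUniformlyOn A A' U (ball 0 1) ∧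
      ∀ z ∈ ball (0 : ℂ) 1, ∀ w ∈ ball (0 : ℂ) 1, ‖A' z - A' w‖ ≤ K * ‖z - w‖ ^ α := by
  have hlim : ∀ z : ℂ, ∃ a, z ∈ ball (0 : ℂ) 1 → Tendsto (fun i => A i z) U (𝓝 a) := by
    intro z
    by_cases hz : z ∈ ball (0 : ℂ) 1
    swap
    · exact ⟨0, fun h => absurd h hz⟩
    have hmem : closedBall (0 : ℂ) (1 + K) ∈ U.map fun i => A i z := by
      change ∀ᶠ i in (U : Filter ι), A i z ∈ closedBall (0 : ℂ) (1 + K)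
      filter_upwards [h0, h] with i hi0 hi
      have h1 := hi z hz 0 (mem_ball_self one_pos)
      have h2 : ‖z - 0‖ ^ α ≤ 1 :=
        Real.rpow_le_one (norm_nonneg _) (by simpa using (mem_ball_zero_iff.1 hz).le) hα.le
      have h3 := mul_le_of_le_one_right hK h2
      have h4 := norm_sub_norm_le (A i z) (A i 0)
      rw [mem_closedBall_zero_iff]
      linarith
    obtain ⟨a, -, ha⟩ := (isCompact_closedBall (0 : ℂ) (1 + K)).ultrafilter_le_nhds'
      (U.map fun i => A i z) hmem
    exact ⟨a, fun _ => ha⟩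
  choose A' hA' using hlim
  have hA'K : ∀ z ∈ ball (0 : ℂ) 1, ∀ w ∈ ball (0 : ℂ) 1,
      ‖A' z - A' w‖ ≤ K * ‖z - w‖ ^ α := fun z hz w hw =>
    le_of_tendsto ((hA' z hz).sub (hA' w hw)).norm (h.mono fun i hi => hi z hz w hw)
  refine ⟨A', Metric.tendstoUniformlyOn_iff.2 fun ε hε => ?_, hA'K⟩
  -- On a finite `δ`-net pointwise convergence is uniform; moving to the net costs at most `ε / 4`
  -- for each of `A i` and `A'`.
  set δ : ℝ := (ε / (4 * (K + 1))) ^ (1 / α) with hδ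
  have hδ0 : 0 < δ := by positivity
  have hδα : K * δ ^ α ≤ ε / 4 := by
    rw [hδ, ← Real.rpow_mul (by positivity), one_div_mul_cancel hα.ne', Real.rpow_one, mul_div,
      div_le_div_iff₀ (by positivity) (by norm_num)]
    nlinarith
  have htb : TotallyBounded (ball (0 : ℂ) 1) :=
    (isCompact_closedBall (0 : ℂ) 1).totallyBounded.subset ball_subset_closedBall
  obtain ⟨t, htsub, htfin, ht⟩ := Metric.finite_approx_of_totallyBounded htb δ hδ0
  have hnet : ∀ᶠ i in (U : Filter ι), ∀ y ∈ t, ‖A' y - A i y‖ < ε / 4 := by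
    refine (htfin.eventually_all).2 fun y hy => ?_
    have := Metric.tendsto_nhds.1 (hA' y (htsub hy)) (ε / 4) (by positivity)
    simpa only [dist_eq_norm, norm_sub_rev] using this
  filter_upwards [h, hnet] with i hi hin z hz
  obtain ⟨y, hy, hzy⟩ := mem_iUnion₂.1 (ht hz)
  have hd : K * ‖z - y‖ ^ α ≤ ε / 4 := by
    refine le_trans (mul_le_mul_of_nonneg_left (Real.rpow_le_rpow (norm_nonneg _) ?_ hα.le) hK) hδα
    rw [← dist_eq_norm]
    exact (mem_ball.1 hzy).le
  have h1 := hi z hz y (htsub hy)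
  have h2 := hA'K z hz y (htsub hy)
  have h3 := hin y hy
  rw [dist_eq_norm,
    show A' z - A i z = (A' z - A' y) + (A' y - A i y) - (A i z - A i y) by ring]
  have h4 := norm_sub_le ((A' z - A' y) + (A' y - A i y)) (A i z - A i y)
  have h5 := norm_add_le (A' z - A' y) (A' y - A i y)
  linarith

/-- Where `φ z` is within `δ` of the circle, smallness comes from `φ` through `ε`, against the crude
bound `L`; elsewhere it comes from `A`, whose derivative is at most `η / δ`, against the crude bound
`C`. -/
theorem norm_fderiv_mul_le_of_small {A : ℂ → ℂ} {L ε η δ C : ℝ} (hφ : MapsTo φ (UnitBall E) (UnitBall ℂ))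
    (hα : α < 1) (hL : 0 ≤ L) (hη : 0 ≤ η) (hδ : 0 < δ)
    (hC : ∀ z ∈ UnitBall E,
      ‖fderiv ℂ φ z‖ * (1 - ‖φ z‖) ^ (α - 1) ≤ C * (1 - ‖z‖) ^ (β - 1))
    (hε : ∀ z ∈ UnitBall E, 1 - ‖φ z‖ ≤ δ →
      ‖fderiv ℂ φ z‖ * (1 - ‖φ z‖) ^ (α - 1) ≤ ε * (1 - ‖z‖) ^ (β - 1))
    (h1 : ∀ w ∈ ball (0 : ℂ) 1, ‖fderiv ℂ A w‖ ≤ L * (1 - ‖w‖) ^ (α - 1))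
    (h2 : ∀ w ∈ ball (0 : ℂ) 1, ‖fderiv ℂ A w‖ ≤ η / (1 - ‖w‖)) {M : ℝ}
    (hM1 : L * ε ≤ M) (hM2 : η / δ * C ≤ M) {z : E} (hz : z ∈ UnitBall E) :
    ‖fderiv ℂ A (φ z)‖ * ‖fderiv ℂ φ z‖ ≤ M * (1 - ‖z‖) ^ (β - 1) := by
  have hz1 : 0 < 1 - ‖z‖ := by simpa using hz
  have hw1 : 0 < 1 - ‖φ z‖ := by simpa using hφ hz
  have hp : 0 < (1 - ‖z‖) ^ (β - 1) := by positivity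
  rcases le_total (1 - ‖φ z‖) δ with hle | hle
  · have h3 := mul_le_mul_of_nonneg_right (h1 _ (hφ hz)) (norm_nonneg (fderiv ℂ φ z))
    have h4 := mul_le_mul_of_nonneg_left (hε z hz hle) hL
    have h5 := mul_le_mul_of_nonneg_right hM1 hp.le
    linarith
  · have h3 : ‖fderiv ℂ A (φ z)‖ ≤ η / δ :=
      (h2 _ (hφ hz)).trans (by gcongr)
    have h4 : 1 ≤ (1 - ‖φ z‖) ^ (α - 1) :=
      Real.one_le_rpow_of_pos_of_le_one_of_nonpos hw1 (by linarith [norm_nonneg (φ z)])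
        (by linarith)
    have h5 : ‖fderiv ℂ φ z‖ ≤ C * (1 - ‖z‖) ^ (β - 1) :=
      (le_mul_of_one_le_right (norm_nonneg _) h4).trans (hC z hz)
    have h6 := mul_le_mul h3 h5 (norm_nonneg _) (by positivity)
    have h7 := mul_le_mul_of_nonneg_right hM2 hp.le
    linarith

end Operator

/-! ### Sufficiency for compactness. -/

section CompactOperator

variable {E : Type*} [NormedAddCommGroup E] [NormedSpace ℂ E] {φ : E → ℂ} {α β : ℝ}

/-- Along an ultrafilter on the unit ball of `𝓛_α ∩ 𝒫ℋ`, some `g` in the unit ball satisfies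
`f - g = Re A + i Re B` with `A`, `B` small and uniformly controlled. -/
theorem LipPH.exists_limit_of_ultrafilter (hα : α ∈ Ioo 0 1) (U : Ultrafilter (LipPH α ℂ))
    (hU : closedBall (0 : LipPH α ℂ) 1 ∈ U) :
    ∃ g ∈ closedBall (0 : LipPH α ℂ) 1, ∃ A B : LipPH α ℂ → ℂ → ℂ,
      (∀ f, IsRePair (f - g).toFun (A f) (B f)) ∧
      (∃ L, 0 ≤ L ∧ ∀ᶠ f in (U : Filter (LipPH α ℂ)), ∀ w ∈ ball (0 : ℂ) 1,
        ‖fderiv ℂ (A f) w‖ ≤ L * (1 - ‖w‖) ^ (α - 1) ∧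
        ‖fderiv ℂ (B f) w‖ ≤ L * (1 - ‖w‖) ^ (α - 1)) ∧
      ∀ η > 0, ∀ᶠ f in (U : Filter (LipPH α ℂ)), ∀ w ∈ ball (0 : ℂ) 1,
        ‖A f w‖ ≤ η ∧ ‖B f w‖ ≤ η := by
  choose A B hAB hA0 hB0 hA hB using LipPH.exists_isRePair hα
  have hα0 := hα.1
  set K : ℝ := (2 / α + 2) * 4 with hK
  have hK0 : 0 ≤ K := by positivity
  have hball : ∀ᶠ f in (U : Filter (LipPH α ℂ)), ‖f‖ ≤ 1 :=
    mem_of_superset hU fun f hf => mem_closedBall_zero_iff.1 hf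
  have hhol : ∀ {F : LipPH α ℂ → ℂ → ℂ}, (∀ f, DifferentiableOn ℂ (F f) (ball 0 1)) →
      (∀ f, ∀ w ∈ ball (0 : ℂ) 1, ‖fderiv ℂ (F f) w‖ ≤ 4 * ‖f‖ * (1 - ‖w‖) ^ (α - 1)) →
      ∀ᶠ f in (U : Filter (LipPH α ℂ)), ∀ z ∈ ball (0 : ℂ) 1, ∀ w ∈ ball (0 : ℂ) 1,
        ‖F f z - F f w‖ ≤ K * ‖z - w‖ ^ α := by
    intro F hF hb
    filter_upwards [hball] with f hf z hz w hw
    have h1 := holder_of_norm_fderiv_le hα (M := 4) (by norm_num) (hF f) (fun y hy => by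
      have : 0 < 1 - ‖y‖ := by simpa using hy
      refine (hb f y hy).trans (mul_le_mul_of_nonneg_right (by linarith) (by positivity))) hz hw
    exact h1
  have hAK := hhol (fun f => (hAB f).left) hA
  have hBK := hhol (fun f => (hAB f).right) hB
  have hzero : ∀ {w : ℂ}, w.im = 0 → ‖w‖ = |w.re| := fun {w} hw => by
    rw [← Complex.abs_re_eq_norm.2 hw]
  have hA1 : ∀ᶠ f in (U : Filter (LipPH α ℂ)), ‖A f 0‖ ≤ 1 := by
    filter_upwards [hball] with f hf
    rw [hzero (hA0 f)]
    have h1 := (hAB f).re_apply (UnitBall.center ℂ)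
    simp only [UnitBall.center] at h1
    rw [← h1]
    exact (Complex.abs_re_le_norm _).trans (f.norm_center_le.trans hf)
  have hB1 : ∀ᶠ f in (U : Filter (LipPH α ℂ)), ‖B f 0‖ ≤ 1 := by
    filter_upwards [hball] with f hf
    rw [hzero (hB0 f)]
    have h1 := (hAB f).im_apply (UnitBall.center ℂ)
    simp only [UnitBall.center] at h1
    rw [← h1]
    exact (Complex.abs_im_le_norm _).trans (f.norm_center_le.trans hf)
  obtain ⟨A', hA', hA'K⟩ := exists_tendstoUniformlyOn_of_holder U hα0 hK0 hA1 hAK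
  obtain ⟨B', hB', hB'K⟩ := exists_tendstoUniformlyOn_of_holder U hα0 hK0 hB1 hBK
  have hA'd : DifferentiableOn ℂ A' (ball 0 1) :=
    hA'.tendstoLocallyUniformlyOn.differentiableOn
      (Eventually.of_forall fun f => (hAB f).left) isOpen_ball
  have hB'd : DifferentiableOn ℂ B' (ball 0 1) :=
    hB'.tendstoLocallyUniformlyOn.differentiableOn
      (Eventually.of_forall fun f => (hAB f).right) isOpen_ball
  set g₀ : UnitBall ℂ → ℂ := fun z => ((A' z).re : ℂ) + Complex.I * ((B' z).re : ℂ) with hg₀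
  have hg₀r : IsRePair g₀ A' B' := ⟨hA'd, hB'd, fun z => rfl⟩
  have hlim : ∀ z : UnitBall ℂ, Tendsto (fun f : LipPH α ℂ => f z) U (𝓝 (g₀ z)) := by
    intro z
    have h1 := (Complex.continuous_re.tendsto _).comp (hA'.tendsto_at z.2)
    have h2 := (Complex.continuous_re.tendsto _).comp (hB'.tendsto_at z.2)
    refine (((Complex.continuous_ofReal.tendsto _).comp h1).add
      (((Complex.continuous_ofReal.tendsto _).comp h2).const_mul Complex.I)).congr fun f => ?_
    exact ((hAB f).apply z).symm
  -- Keeping `1 - ‖g₀ 0‖` as the Hölder constant, rather than 1, puts the limit in the closed unit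
  -- ball itself.
  have hg₀h : ∀ z w : UnitBall ℂ, ‖g₀ z - g₀ w‖ ≤
      (1 - ‖g₀ (UnitBall.center ℂ)‖) * ‖(z : ℂ) - w‖ ^ α := by
    intro z w
    refine le_of_tendsto_of_tendsto ((hlim z).sub (hlim w)).norm
      (((hlim (UnitBall.center ℂ)).norm.const_sub 1).mul_const _) ?_
    filter_upwards [hball] with f hf
    refine (f.norm_sub_le_seminorm z w).trans (mul_le_mul_of_nonneg_right ?_ (by positivity))
    rw [LipPH.norm_def] at hf
    linarith
  have hg₀0 : 0 ≤ 1 - ‖g₀ (UnitBall.center ℂ)‖ :=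
    ge_of_tendsto ((hlim (UnitBall.center ℂ)).norm.const_sub 1) (hball.mono fun f hf => by
      linarith [f.norm_center_le])
  set g : LipPH α ℂ := LipPH.ofHolder g₀ hg₀r.isPluriharmonic _ hg₀h with hg
  have hg1 : ‖g‖ ≤ 1 := by
    have h1 := LipPH.norm_le_of_holder hg₀0 g hg₀h
    have h2 : g (UnitBall.center ℂ) = g₀ (UnitBall.center ℂ) := rfl
    rw [h2] at h1
    linarith
  refine ⟨g, mem_closedBall_zero_iff.2 hg1, fun f z => A f z - A' z, fun f z => B f z - B' z,
    fun f => (hAB f).sub hg₀r, ⟨2 * K, by positivity, ?_⟩, fun η hη => ?_⟩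
  · have hsub : ∀ {F F' : ℂ → ℂ}, DifferentiableOn ℂ F (ball 0 1) →
        DifferentiableOn ℂ F' (ball 0 1) →
        (∀ z ∈ ball (0 : ℂ) 1, ∀ w ∈ ball (0 : ℂ) 1, ‖F z - F w‖ ≤ K * ‖z - w‖ ^ α) →
        (∀ z ∈ ball (0 : ℂ) 1, ∀ w ∈ ball (0 : ℂ) 1, ‖F' z - F' w‖ ≤ K * ‖z - w‖ ^ α) →
        ∀ w ∈ ball (0 : ℂ) 1,
          ‖fderiv ℂ (fun z => F z - F' z) w‖ ≤ 2 * K * (1 - ‖w‖) ^ (α - 1) := by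
      intro F F' hF hF' h h' w hw
      refine norm_fderiv_le_of_holder hα0 (by positivity) (hF.fun_sub hF') (fun z hz w hw => ?_) hw
      rw [show F z - F' z - (F w - F' w) = (F z - F w) - (F' z - F' w) by ring]
      linarith [_root_.norm_sub_le (F z - F w) (F' z - F' w), h z hz w hw, h' z hz w hw]
    filter_upwards [hAK, hBK] with f hfA hfB w hw
    exact ⟨hsub (hAB f).left hA'd hfA hA'K w hw, hsub (hAB f).right hB'd hfB hB'K w hw⟩
  · filter_upwards [Metric.tendstoUniformlyOn_iff.1 hA' η hη,
      Metric.tendstoUniformlyOn_iff.1 hB' η hη] with f hfA hfB w hw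
    rw [← dist_eq_norm, ← dist_eq_norm, dist_comm, dist_comm (B f w)]
    exact ⟨(hfA w hw).le, (hfB w hw).le⟩

/-- The image of the closed unit ball is itself compact: an ultrafilter on it lifts to the ball, and
`T` sends the lifted one to `T g`, with `g` the limit function. -/
theorem isCompactOperator_of_norm_fderiv_le (hα : α ∈ Ioo 0 1)
    (hβ : β ∈ Ioo 0 1) (hφ : DifferentiableOn ℂ φ (UnitBall E))
    (hmaps : MapsTo φ (UnitBall E) (UnitBall ℂ)) {C : ℝ} (hC : 0 ≤ C)
    (h : ∀ z ∈ UnitBall E,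
      ‖fderiv ℂ φ z‖ * (1 - ‖φ z‖) ^ (α - 1) ≤ C * (1 - ‖z‖) ^ (β - 1))
    (hsmall : ∀ ε > 0, ∃ δ > 0, ∀ z ∈ UnitBall E, 1 - ‖φ z‖ ≤ δ →
      ‖fderiv ℂ φ z‖ * (1 - ‖φ z‖) ^ (α - 1) ≤ ε * (1 - ‖z‖) ^ (β - 1))
    (T : LipPH α ℂ →L[ℂ] LipPH β E) (hT : ∀ f : LipPH α ℂ, (T f).toFun = compOp hmaps f) :
    IsCompactOperator T := by
  have hβ0 := hβ.1
  refine (isCompactOperator_iff_image_closedBall_subset_compact (T : LipPH α ℂ →ₗ[ℂ] LipPH β E)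
    one_pos).2 ⟨T '' closedBall 0 1, ?_, subset_rfl⟩
  refine isCompact_iff_ultrafilter_le_nhds.2 fun V hV => ?_
  have hVm : T '' closedBall 0 1 ∈ V := le_principal_iff.1 hV
  set U := Ultrafilter.ofComapInfPrincipal hVm with hUdef
  have hUm : closedBall (0 : LipPH α ℂ) 1 ∈ U := Ultrafilter.ofComapInfPrincipal_mem hVm
  have hUV : U.map T = V := Ultrafilter.ofComapInfPrincipal_eq_of_map hVm
  obtain ⟨g, hg, A, B, hAB, ⟨L, hL, hAL⟩, hη⟩ := LipPH.exists_limit_of_ultrafilter hα U hUm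
  refine ⟨T g, mem_image_of_mem _ hg, ?_⟩
  rw [← hUV]
  change Tendsto T U (𝓝 (T g))
  refine Metric.tendsto_nhds.2 fun ε hε => ?_
  set c : ℝ := 2 * (2 / β + 2) with hc
  have hc0 : 0 < c := by positivity
  set M : ℝ := ε / (4 * c) with hM
  have hM0 : 0 < M := by positivity
  obtain ⟨δ, hδ, hδs⟩ := hsmall (M / (L + 1)) (by positivity)
  -- The first bound makes the value at the centre at most `2η ≤ ε / 4`; the second gives `η / δ * C
  -- ≤ M`. The semi-norm contributes `c * M = ε / 4`.
  set η : ℝ := min (ε / 8) (M * δ / (C + 1)) with hηdef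
  have hη0 : 0 < η := by positivity
  have hM1 : L * (M / (L + 1)) ≤ M := by
    rw [mul_div, div_le_iff₀ (by positivity)]
    nlinarith
  have hM2 : η / δ * C ≤ M := by
    have h1 : η ≤ M * δ / (C + 1) := min_le_right _ _
    rw [div_mul_eq_mul_div, div_le_iff₀ hδ]
    rw [le_div_iff₀ (by positivity)] at h1
    linarith
  filter_upwards [hAL, hη η hη0] with f hfL hfη
  have hder : ∀ {F : ℂ → ℂ}, DifferentiableOn ℂ F (ball 0 1) →
      (∀ w ∈ ball (0 : ℂ) 1, ‖F w‖ ≤ η) → ∀ w ∈ ball (0 : ℂ) 1,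
      ‖fderiv ℂ F w‖ ≤ η / (1 - ‖w‖) := fun {F} hF hb w hw => by
    have hsub : ball w (1 - ‖w‖) ⊆ ball 0 1 := ball_subset_ball' (by simp)
    exact norm_fderiv_le_of_forall_ball (by simpa using hw) (hF.mono hsub)
      fun y hy => hb y (hsub hy)
  have hol := (hAB f).norm_compOp_sub_le hφ hmaps hβ hM0.le
    (fun z hz => norm_fderiv_mul_le_of_small hmaps hα.2 hL hη0.le hδ h hδs
      (fun w hw => (hfL w hw).1) (hder (hAB f).left fun w hw => (hfη w hw).1) hM1 hM2 hz)
    (fun z hz => norm_fderiv_mul_le_of_small hmaps hα.2 hL hη0.le hδ h hδs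
      (fun w hw => (hfL w hw).2) (hder (hAB f).right fun w hw => (hfη w hw).2) hM1 hM2 hz)
  have hnorm := LipPH.norm_le_of_holder (N := c * M) (by positivity) (T (f - g)) (by rw [hT]; exact hol)
  have h0 : ‖(T (f - g)) (UnitBall.center E)‖ ≤ 2 * η := by
    rw [hT]
    refine ((hAB f).norm_apply_le (hmaps.restrict φ _ _ (UnitBall.center E))).trans ?_
    have := hfη _ (hmaps.restrict φ _ _ (UnitBall.center E)).2
    linarith [this.1, this.2]
  have h1 : η ≤ ε / 8 := min_le_left _ _
  have h2 : c * M = ε / 4 := by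
    rw [hM]
    field_simp
  rw [dist_eq_norm, ← map_sub]
  linarith

end CompactOperator

/-! ### Necessity, by testing on monomials. -/

section Necessity

variable {n : ℕ} {α β : ℝ} {φ : EuclideanSpace ℂ (Fin n) → ℂ}

/-- The normalised monomial `k ^ (-α) w ^ k`. -/
noncomputable def LipPH.normalizedMonomial (hα : α ∈ Ioo 0 1) (k : ℕ) : LipPH α ℂ :=
  (((k : ℝ) ^ (-α) : ℝ) : ℂ) • LipPH.monomial hα k

theorem LipPH.norm_normalizedMonomial_le (hα : α ∈ Ioo 0 1) {k : ℕ} (hk : 1 ≤ k) :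
    ‖LipPH.normalizedMonomial hα k‖ ≤ 2 := by
  have hk0 : (0 : ℝ) < k := by exact_mod_cast hk
  rw [LipPH.normalizedMonomial, norm_smul, Complex.norm_real, Real.norm_of_nonneg (by positivity)]
  refine (mul_le_mul_of_nonneg_left (LipPH.norm_monomial_le hα hk) (by positivity)).trans
    (le_of_eq ?_)
  rw [mul_left_comm, ← Real.rpow_add hk0, neg_add_cancel, Real.rpow_zero, mul_one]

/-- The norm of `T p` bounds both the value of `φ^k` at the centre and, by Cauchy's estimate, the
weighted derivative; hence the factor 2. -/
theorem rpow_mul_blochNorm_pow_le (hα : α ∈ Ioo 0 1) (hβ : β ∈ Ioo 0 1)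
    (hφ : DifferentiableOn ℂ φ (UnitBall (EuclideanSpace ℂ (Fin n))))
    (hmaps : MapsTo φ (UnitBall (EuclideanSpace ℂ (Fin n))) (UnitBall ℂ))
    (T : LipPH α ℂ →L[ℂ] LipPH β (EuclideanSpace ℂ (Fin n)))
    (hT : ∀ f : LipPH α ℂ, (T f).toFun = compOp hmaps f) {k : ℕ} (hk : 1 ≤ k) :
    (k : ℝ≥0∞) ^ (-α) * blochNorm (lipWeight β) (fun z => φ z ^ k) ≤
      ENNReal.ofReal (2 * ‖T (LipPH.normalizedMonomial hα k)‖) := by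
  set p := LipPH.monomial hα k with hp
  have hTp : ∀ z : UnitBall (EuclideanSpace ℂ (Fin n)), (T p) z = φ z ^ k := fun z => by
    rw [hT]
    rfl
  have hb : blochNorm (lipWeight β) (fun z => φ z ^ k) ≤ ENNReal.ofReal (‖T p‖ + ‖T p‖) := by
    refine blochNorm_le_ofReal (hφ.fun_pow k) (norm_nonneg _) ?_ fun z hz => ?_
    · have := (T p).norm_center_le
      rwa [hTp] at this
    · refine norm_fderiv_le_of_holder hβ.1 (norm_nonneg _) (hφ.fun_pow k)
        (fun z hz w hw => ?_) hz
      have := (T p).norm_sub_le ⟨z, hz⟩ ⟨w, hw⟩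
      rwa [hTp, hTp] at this
  have hn : ‖T (LipPH.normalizedMonomial hα k)‖ = (k : ℝ) ^ (-α) * ‖T p‖ := by
    rw [LipPH.normalizedMonomial, map_smul, norm_smul, Complex.norm_real,
      Real.norm_of_nonneg (by positivity)]
  rw [hn, natCast_rpow_eq_ofReal hk,
    show 2 * ((k : ℝ) ^ (-α) * ‖T p‖) = (k : ℝ) ^ (-α) * (‖T p‖ + ‖T p‖) by ring,
    ENNReal.ofReal_mul (by positivity)]
  gcongr

/-- In a compact set it is enough that 0 is the only cluster point. Evaluations are continuous, and
the values `k^(-α) φ(z)^k` tend to 0. -/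
theorem tendsto_normalizedMonomial_of_isCompactOperator (hα : α ∈ Ioo 0 1) (hβ : β ∈ Ioo 0 1)
    (hmaps : MapsTo φ (UnitBall (EuclideanSpace ℂ (Fin n))) (UnitBall ℂ))
    (T : LipPH α ℂ →L[ℂ] LipPH β (EuclideanSpace ℂ (Fin n)))
    (hT : ∀ f : LipPH α ℂ, (T f).toFun = compOp hmaps f) (hTc : IsCompactOperator T) :
    Tendsto (fun k => T (LipPH.normalizedMonomial hα k)) atTop (𝓝 0) := by
  obtain ⟨K, hK, hTK⟩ := IsCompactOperator.image_closedBall_subset_compact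
    (f := (T : LipPH α ℂ →ₗ[ℂ] LipPH β (EuclideanSpace ℂ (Fin n)))) hTc 2
  refine hK.tendsto_nhds_of_unique_mapClusterPt ?_ fun x _ hx => ?_
  · filter_upwards [eventually_ge_atTop 1] with k hk
    exact hTK (mem_image_of_mem _
      (mem_closedBall_zero_iff.2 (LipPH.norm_normalizedMonomial_le hα hk)))
  · refine LipPH.ext (funext fun z => ?_)
    have hcont : Continuous fun f : LipPH β (EuclideanSpace ℂ (Fin n)) => f z := by
      refine continuous_iff_continuousAt.2 fun f => ?_
      rw [ContinuousAt, tendsto_iff_norm_sub_tendsto_zero]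
      exact squeeze_zero (fun _ => norm_nonneg _) (fun g => (g - f).norm_apply_le hβ.1.le z)
        (tendsto_iff_norm_sub_tendsto_zero.1 tendsto_id)
    have hcl : MapClusterPt (x z) atTop fun k => (T (LipPH.normalizedMonomial hα k)) z :=
      hx.continuousAt_comp hcont.continuousAt
    have hlim : Tendsto (fun k => (T (LipPH.normalizedMonomial hα k)) z) atTop (𝓝 0) := by
      have h1 : Tendsto (fun k : ℕ => (k : ℝ) ^ (-α)) atTop (𝓝 0) :=
        (tendsto_rpow_neg_atTop hα.1).comp tendsto_natCast_atTop_atTop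
      refine squeeze_zero_norm (fun k => ?_) h1
      rw [hT]
      have h2 : ‖φ z‖ ≤ 1 := (mem_ball_zero_iff.1 (hmaps z.2)).le
      change ‖(((k : ℝ) ^ (-α) : ℝ) : ℂ) * φ z ^ k‖ ≤ _
      rw [norm_mul, Complex.norm_real, Real.norm_of_nonneg (by positivity), norm_pow]
      exact mul_le_of_le_one_right (by positivity) (pow_le_one₀ (norm_nonneg _) h2)
    have : (𝓝 (x z) ⊓ 𝓝 0).NeBot := ClusterPt.mono hcl hlim
    exact eq_of_nhds_neBot this

end Necessity

/-! ### From powers of `φ` to the pointwise inequality. -/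

section Sufficiency

variable {n : ℕ} {α β : ℝ} {φ : EuclideanSpace ℂ (Fin n) → ℂ}

/-- A bound for all large powers controls the derivative of `φ` where `|φ|` is close to one. -/
theorem norm_fderiv_mul_rpow_le_of_blochNorm_pow_le (hα : α ∈ Ioo 0 1)
    (hφ : DifferentiableOn ℂ φ (UnitBall (EuclideanSpace ℂ (Fin n))))
    (hmaps : MapsTo φ (UnitBall (EuclideanSpace ℂ (Fin n))) (UnitBall ℂ)) {S : ℝ} (hS : 0 ≤ S)
    {m : ℕ} (h : ∀ k : ℕ, 1 ≤ k → m ≤ k →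
      (k : ℝ≥0∞) ^ (-α) * blochNorm (lipWeight β) (fun z => φ z ^ k) ≤ ENNReal.ofReal S)
    {z : EuclideanSpace ℂ (Fin n)} (hz : z ∈ UnitBall (EuclideanSpace ℂ (Fin n)))
    (hm : (m : ℝ) ≤ 1 / (2 * (1 - ‖φ z‖))) :
    ‖fderiv ℂ φ z‖ * (1 - ‖φ z‖) ^ (α - 1) ≤ 4 * S * (1 - ‖z‖) ^ (β - 1) := by
  obtain ⟨k, hk, hkx, hkr⟩ := exists_nat_rpow_mul_pow_ge hα (norm_nonneg (φ z))
    (mem_ball_zero_iff.1 (hmaps hz))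
  have h1 := rpow_mul_norm_fderiv_le_of_blochNorm_le hφ hS hk
    (h k hk (by exact_mod_cast hm.trans hkx)) hz
  have h2 := mul_le_mul_of_nonneg_left hkr (norm_nonneg (fderiv ℂ φ z))
  linarith

/-- The constant `C` is exported because the compactness proof needs the pointwise inequality as
well as the operator. -/
theorem compOpIsBounded_of_iSup_lt_top (hα : α ∈ Ioo 0 1) (hβ : β ∈ Ioo 0 1)
    (hφ : DifferentiableOn ℂ φ (UnitBall (EuclideanSpace ℂ (Fin n))))
    (hmaps : MapsTo φ (UnitBall (EuclideanSpace ℂ (Fin n))) (UnitBall ℂ))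
    (h : (⨆ (k : ℕ) (_ : 1 ≤ k),
      (k : ℝ≥0∞) ^ (-α) * blochNorm (lipWeight β) (fun z => φ z ^ k)) < ∞) :
    ∃ C, 0 ≤ C ∧ (∀ z ∈ UnitBall (EuclideanSpace ℂ (Fin n)),
      ‖fderiv ℂ φ z‖ * (1 - ‖φ z‖) ^ (α - 1) ≤ C * (1 - ‖z‖) ^ (β - 1)) ∧
      CompOpIsBounded α β hmaps := by
  set S := ⨆ (k : ℕ) (_ : 1 ≤ k),
      (k : ℝ≥0∞) ^ (-α) * blochNorm (lipWeight β) (fun z => φ z ^ k) with hS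
  have hb : ∀ z ∈ UnitBall (EuclideanSpace ℂ (Fin n)),
      ‖fderiv ℂ φ z‖ * (1 - ‖φ z‖) ^ (α - 1) ≤ 4 * S.toReal * (1 - ‖z‖) ^ (β - 1) := by
    intro z hz
    have h1 : 0 < 1 - ‖φ z‖ := by simpa using hmaps hz
    refine norm_fderiv_mul_rpow_le_of_blochNorm_pow_le (m := 0) hα hφ hmaps
      ENNReal.toReal_nonneg (fun k hk _ => ?_) hz (by rw [Nat.cast_zero]; positivity)
    rw [ENNReal.ofReal_toReal h.ne]
    exact le_iSup₂ (f := fun (k : ℕ) (_ : 1 ≤ k) =>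
      (k : ℝ≥0∞) ^ (-α) * blochNorm (lipWeight β) (fun z => φ z ^ k)) k hk
  exact ⟨4 * S.toReal, by positivity, hb,
    compOpIsBounded_of_norm_fderiv_le hα hβ hφ hmaps (by positivity) hb⟩

end Sufficiency

/-! ### The two equivalences. -/

theorem iSup_lt_top_of_tendsto_zero {u : ℕ → ℝ≥0∞} (hu : ∀ k, 1 ≤ k → u k < ∞)
    (h : Tendsto u atTop (𝓝 0)) : (⨆ (k : ℕ) (_ : 1 ≤ k), u k) < ∞ := by
  obtain ⟨m, hm⟩ := eventually_atTop.1 (h.eventually_le_const one_pos)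
  refine lt_of_le_of_lt (b := 1 + ∑ k ∈ Finset.Ico 1 m, u k) (iSup₂_le fun k hk => ?_) ?_
  · rcases le_or_gt m k with hmk | hmk
    · exact (hm k hmk).trans le_self_add
    · exact (Finset.single_le_sum (f := u) (fun _ _ => zero_le)
        (Finset.mem_Ico.2 ⟨hk, hmk⟩)).trans le_add_self
  · exact ENNReal.add_lt_top.2 ⟨ENNReal.one_lt_top,
      ENNReal.sum_lt_top.2 fun k hk => hu k (Finset.mem_Ico.1 hk).1⟩

theorem mainTheorem5 (n : ℕ) (hn : 1 ≤ n) (α β : ℝ) (hα : α ∈ Set.Ioo (0 : ℝ) 1)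
    (hβ : β ∈ Set.Ioo (0 : ℝ) 1) (φ : EuclideanSpace ℂ (Fin n) → ℂ)
    (hφ : DifferentiableOn ℂ φ (UnitBall (EuclideanSpace ℂ (Fin n))))
    (hmaps : Set.MapsTo φ (UnitBall (EuclideanSpace ℂ (Fin n))) (UnitBall ℂ)) :
    (CompOpIsBounded α β hmaps ↔
      (⨆ (k : ℕ) (_ : 1 ≤ k),
        (k : ℝ≥0∞) ^ (-α) * blochNorm (lipWeight β) (fun z => φ z ^ k)) < ∞) ∧
    (CompOpIsCompact α β hmaps ↔
      (∀ k : ℕ, 1 ≤ k → blochNorm (lipWeight β) (fun z => φ z ^ k) < ∞) ∧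
      Filter.Tendsto
        (fun k : ℕ => (k : ℝ≥0∞) ^ (-α) * blochNorm (lipWeight β) (fun z => φ z ^ k))
        Filter.atTop (nhds 0)) := by
  refine ⟨⟨?_, fun h => ?_⟩, ?_, ?_⟩
  · rintro ⟨T, hT⟩
    refine lt_of_le_of_lt (iSup₂_le fun k hk => ?_)
      (ENNReal.ofReal_lt_top (r := 2 * (‖T‖ * 2)))
    refine (rpow_mul_blochNorm_pow_le hα hβ hφ hmaps T hT hk).trans (ENNReal.ofReal_le_ofReal ?_)
    gcongr
    exact T.le_opNorm_of_le (LipPH.norm_normalizedMonomial_le hα hk)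
  · obtain ⟨C, -, -, hC⟩ := compOpIsBounded_of_iSup_lt_top hα hβ hφ hmaps h
    exact hC
  · rintro ⟨T, hT, hTc⟩
    refine ⟨fun k hk => ?_, ?_⟩
    · have h1 := (rpow_mul_blochNorm_pow_le hα hβ hφ hmaps T hT hk).trans_lt ENNReal.ofReal_lt_top
      have hk0 : (0 : ℝ) < (k : ℝ) ^ (-α) :=
        Real.rpow_pos_of_pos (by exact_mod_cast hk) _
      refine ENNReal.lt_top_of_mul_ne_top_right h1.ne ?_
      rw [natCast_rpow_eq_ofReal hk]
      simpa using hk0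
    · have h1 := ((tendsto_normalizedMonomial_of_isCompactOperator hα hβ hmaps T hT
        hTc).norm.const_mul 2)
      rw [norm_zero, mul_zero] at h1
      have h2 := ENNReal.tendsto_ofReal h1
      rw [ENNReal.ofReal_zero] at h2
      refine tendsto_of_tendsto_of_tendsto_of_le_of_le' tendsto_const_nhds h2
        (Eventually.of_forall fun _ => zero_le) ?_
      -- For `k = 0` the factor `(0 : ℝ≥0∞) ^ (-α)` is `∞`.
      filter_upwards [eventually_ge_atTop 1] with k hk
      exact rpow_mul_blochNorm_pow_le hα hβ hφ hmaps T hT hk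
  · rintro ⟨hfin, hlim⟩
    have hsup := iSup_lt_top_of_tendsto_zero (fun k hk => by
      rw [natCast_rpow_eq_ofReal hk]
      exact ENNReal.mul_lt_top ENNReal.ofReal_lt_top (hfin k hk)) hlim
    obtain ⟨C, hC, hCb, T, hT⟩ := compOpIsBounded_of_iSup_lt_top hα hβ hφ hmaps hsup
    refine ⟨T, hT, isCompactOperator_of_norm_fderiv_le hα hβ hφ hmaps hC hCb (fun ε hε => ?_) T hT⟩
    obtain ⟨m, hm⟩ := eventually_atTop.1 (hlim.eventually_le_const
      (ENNReal.ofReal_pos.2 (show 0 < ε / 4 by positivity)))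
    -- This `δ` forces `m ≤ 1 / (2 (1 - ‖φ z‖))`, so the power selected at `z` is at least `m`; `ε /
    -- 4` absorbs the factor 4.
    refine ⟨1 / (2 * (m + 1)), by positivity, fun z hz hzδ => ?_⟩
    have h1 : 0 < 1 - ‖φ z‖ := by simpa using hmaps hz
    have h2 := norm_fderiv_mul_rpow_le_of_blochNorm_pow_le hα hφ hmaps (S := ε / 4)
      (by positivity) (fun k _ hk => hm k hk) hz (by
        rw [le_div_iff₀ (by positivity)] at hzδ ⊢
        nlinarith)
    rwa [mul_div_cancel₀ ε (by norm_num)] at h2
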